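/- Let $d\ge1$, let $\ell\ge2$ be even, $\beta\ge0$, and let $n=2S+1\in\{2,3,4,\dots\}$. Let $S_x^{(1)},S_x^{(2)},S_x^{(3)}$ be the usual spin-$S$ operators at the sites $x$ of the periodic box $\Lambda_\ell=\{0,1,\dots,\ell-1\}^d$ (coordinates modulo $\ell$), acting on $\bigotimes_{x\in\Lambda_\ell}\mathbb C^n$. **Couplings.** Call a function $K:\mathbb Z^d\to\mathbb R$ *basic* if it has one of the following forms, with $a\in\mathbb R$: 1. nearest neighbour: $K_x=a$ if $\|x\|_1=1$, and $K_x=0$ otherwise; 2. Yukawa: $K_x=a\,e^{-b\|x\|_1}$ with $b>0$; 3. power law: $K_x=a\,\|x\|_1^{-s}$ for $x\ne0$, with $s>d$ and any value $K_0$; 4. random walk: $K_x=a\sum_{w:0\to x}\bigl(\tfrac{\lambda}{2d}\bigr)^{|w|}$ with $\lambda\in[0,1)$, where the sum is over the nearest-neighbour walks in $\mathbb Z^d$ from $0$ to $x$ and $|w|$ is the number of steps; 5. Euclidean power law: $K_x=a\,\|x\|_2^{-s}$ for $x\ne0$, with $s>d$ and any value $K_0$. Assume that each of $J^{(1)}$,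 $-J^{(2)}$ and $J^{(3)}$ is a (finite) convex combination of basic functions that are pointwise nonnegative, and that $$J^{(3)}_x\ \ge\ J^{(1)}_x\ \ge\ -J^{(2)}_x\ \ge\ 0\qquad\text{for all }x\in\mathbb Z^d .$$ Put $J^{(i)}_{x,\mathrm{per}}=\sum_{z\in\mathbb Z^d}J^{(i)}_{x+\ell z}$. **Partition function.** For $v\in\mathbb R^{\Lambda_\ell}$ let $$(\Delta v)_x=\sum_{y\in\Lambda_\ell}J^{(3)}_{x-y,\mathrm{per}}(v_y-v_x),\qquad H(v)=-\sum_{i=1}^3\sum_{x,y\in\Lambda_\ell}J^{(i)}_{x-y,\mathrm{per}}S^{(i)}_xS^{(i)}_y-\sum_{x\in\Lambda_\ell}(\Delta v)_x\,S^{(3)}_x,$$ $$Z(v)=\operatorname{Tr}e^{-\beta H(v)},\qquad \tilde Z(v)=e^{\frac14\beta(v,\Delta v)}\,Z(v),$$ where $(u,v)=\sum_{x\in\Lambda_\ell} u_xv_x$. **Reflections.** Let $j\in\{1,\dots,d\}$ and let $\epsilon\in\mathbb Z+\frac12$. Modulo $\ell$, let $\mathcal R$ be the reflection of $\Lambda_\ell$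 that replaces $x_j$ by $2\epsilon-x_j$, and let $\Lambda_{\rm left}$ and $\Lambda_{\rm right}$ be the sets of sites with $\epsilon-\frac\ell2<x_j<\epsilon$ and with $\epsilon<x_j<\epsilon+\frac\ell2$, respectively. For $v_1\in\mathbb R^{\Lambda_{\rm left}}$ let $(\mathcal Rv_1)_x=(v_1)_{\mathcal Rx}\in\mathbb R^{\Lambda_{\rm right}}$, and define $\mathcal Rv_2\in\mathbb R^{\Lambda_{\rm left}}$ for $v_2\in\mathbb R^{\Lambda_{\rm right}}$ in the same way. **Claim.** For all $v_1\in\mathbb R^{\Lambda_{\rm left}}$ and $v_2\in\mathbb R^{\Lambda_{\rm right}}$, $$\tilde Z(v_1,v_2)^2\ \le\ \tilde Z(v_1,\mathcal Rv_1)\;\tilde Z(\mathcal Rv_2,v_2).$$ -/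

import Mathlib

noncomputable section

namespace SpinRP

/-! ### Coupling functions on `ℤ ^ d` -/

/-- The norm `‖x‖₁` of a lattice vector. -/
def l1norm {d : ℕ} (x : Fin d → ℤ) : ℝ := ∑ j, |(x j : ℝ)|

/-- The Euclidean norm `‖x‖₂` of a lattice vector. -/
def l2norm {d : ℕ} (x : Fin d → ℤ) : ℝ := √(∑ j, (x j : ℝ) ^ 2)

/-- The nearest-neighbour graph of `ℤ ^ d`. -/
def latticeGraph (d : ℕ) : SimpleGraph (Fin d → ℤ) where
  Adj x y := ∑ j, |x j - y j| = 1
  symm := ⟨fun x y h => by simpa only [abs_sub_comm] using h⟩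
  loopless := ⟨fun x h => by simp at h⟩

/-- The listed interactions. The amplitude `a` is an arbitrary real number. In the two power laws,
`‖x‖ ^ (-s)` is undefined at `x = 0` and the value there (a self-interaction) is not restricted. -/
inductive IsBasicCoupling {d : ℕ} (K : (Fin d → ℤ) → ℝ) : Prop
  | nearestNeighbour (a : ℝ) (h : ∀ x, K x = if l1norm x = 1 then a else 0)
  | yukawa (a b : ℝ) (hb : 0 < b) (h : ∀ x, K x = a * Real.exp (-b * l1norm x))
  | powerLaw (a s : ℝ) (hs : (d : ℝ) < s) (h : ∀ x, x ≠ 0 → K x = a * l1norm x ^ (-s))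
  | randomWalk (a lam : ℝ) (h0 : 0 ≤ lam) (h1 : lam < 1)
      (h : ∀ x, K x = a * ∑' w : (latticeGraph d).Walk 0 x, (lam / (2 * d)) ^ w.length)
  | euclidean (a s : ℝ) (hs : (d : ℝ) < s) (h : ∀ x, x ≠ 0 → K x = a * l2norm x ^ (-s))

/-- Convex combinations of listed interactions that are pointwise nonnegative. -/
def Couplings (d : ℕ) : Set ((Fin d → ℤ) → ℝ) :=
  convexHull ℝ {K | IsBasicCoupling K ∧ ∀ x, 0 ≤ K x}

/-! ### The periodic box -/

/-- The box `{0, …, ℓ - 1} ^ d`, with coordinates read modulo `ℓ`. -/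
abbrev Box (d ℓ : ℕ) : Type := Fin d → ZMod ℓ

/-- The periodised coupling `∑_z K (x - y + ℓ z)` between the sites `x` and `y`. -/
def perCoupling {d ℓ : ℕ} (K : (Fin d → ℤ) → ℝ) (x y : Box d ℓ) : ℝ :=
  ∑' z : Fin d → ℤ, K (fun j => ((x j).val : ℤ) - ((y j).val : ℤ) + (ℓ : ℤ) * z j)

/-- The discrete Laplacian `(Δ v)_x = ∑_y K_per (x - y) (v_y - v_x)`. -/
def laplacian {d ℓ : ℕ} [NeZero ℓ] (K : (Fin d → ℤ) → ℝ) (v : Box d ℓ → ℝ) (x : Box d ℓ) : ℝ :=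
  ∑ y, perCoupling K x y * (v y - v x)

/-! ### Spin operators of spin `S = (n - 1) / 2` -/

/-- The raising operator `S⁺` on `ℂ ^ n`, in the basis of eigenvectors of `S⁽³⁾`, where the index
`k` stands for the eigenvalue `S - k`. -/
def spinRaise (n : ℕ) : Matrix (Fin n) (Fin n) ℂ :=
  Matrix.of fun j k => if (j : ℕ) + 1 = k then ((√((k : ℝ) * ((n : ℝ) - k)) : ℝ) : ℂ) else 0

/-- The spin matrices `S⁽¹⁾, S⁽²⁾, S⁽³⁾` on `ℂ ^ n`, indexed by `0, 1, 2`. -/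
def spinMatrix (n : ℕ) : Fin 3 → Matrix (Fin n) (Fin n) ℂ :=
  ![(1 / 2 : ℂ) • (spinRaise n + (spinRaise n).conjTranspose),
    (1 / (2 * Complex.I) : ℂ) • (spinRaise n - (spinRaise n).conjTranspose),
    Matrix.diagonal fun k => ((n : ℂ) - 1) / 2 - (k : ℕ)]

/-- Operators on the tensor product over the sites of `ℂ ^ n`, as matrices in the basis of
configurations. -/
abbrev Operator (d ℓ n : ℕ) : Type :=
  Matrix (Box d ℓ → Fin n) (Box d ℓ → Fin n) ℂ

open Classical in
/-- The operator that acts as `a` at the site `x` and as the identity at all other sites. -/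
def siteOperator {d ℓ n : ℕ} (x : Box d ℓ) (a : Matrix (Fin n) (Fin n) ℂ) : Operator d ℓ n :=
  Matrix.of fun σ τ => if ∀ y, y ≠ x → σ y = τ y then a (σ x) (τ x) else 0

/-- The spin operator `S_x⁽ⁱ⁾`. -/
def spin {d ℓ : ℕ} (n : ℕ) (i : Fin 3) (x : Box d ℓ) : Operator d ℓ n :=
  siteOperator x (spinMatrix n i)

/-- The Hamiltonian `-∑_i ∑_{x,y} J⁽ⁱ⁾_per(x - y) S_x⁽ⁱ⁾ S_y⁽ⁱ⁾ - ∑_x h_x S_x⁽³⁾` with the local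
fields `h = Δ v`, where `Δ` is built with `J⁽³⁾`. -/
def hamiltonian {d ℓ : ℕ} [NeZero ℓ] (n : ℕ) (J : Fin 3 → (Fin d → ℤ) → ℝ) (v : Box d ℓ → ℝ) :
    Operator d ℓ n :=
  -(∑ i, ∑ x, ∑ y, (perCoupling (J i) x y : ℂ) • (spin n i x * spin n i y))
    - ∑ x, (laplacian (J 2) v x : ℂ) • spin n 2 x

/-- The partition function `Z(v) = Tr exp (-β H(v))`; the trace is real because `H(v)` is
hermitian. -/
def partitionFunction {d ℓ : ℕ} [NeZero ℓ] (n : ℕ) (J : Fin 3 → (Fin d → ℤ) → ℝ) (β : ℝ)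
    (v : Box d ℓ → ℝ) : ℝ :=
  (Matrix.trace (NormedSpace.exp (-(β : ℂ) • hamiltonian n J v))).re

/-- The normalised partition function `exp (β (v, Δ v) / 4) Z(v)`. -/
def modifiedPartitionFunction {d ℓ : ℕ} [NeZero ℓ] (n : ℕ) (J : Fin 3 → (Fin d → ℤ) → ℝ) (β : ℝ)
    (v : Box d ℓ → ℝ) : ℝ :=
  Real.exp (β / 4 * ∑ x, v x * laplacian (J 2) v x) * partitionFunction n J β v

/-! ### Reflections through planes that cut edges -/

/-- The reflection across the plane `x_i = ε` with `ε = m + 1/2`: it maps `x_i` to `2ε - x_i`. -/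
def reflect {d ℓ : ℕ} (i : Fin d) (m : ℤ) (x : Box d ℓ) : Box d ℓ :=
  Function.update x i (((2 * m + 1 : ℤ) : ZMod ℓ) - x i)

/-- The sites with `ε - ℓ/2 < x_i < ε` modulo `ℓ`, where `ε = m + 1/2`. -/
def leftHalf {d : ℕ} (ℓ : ℕ) (i : Fin d) (m : ℤ) : Set (Box d ℓ) :=
  {x | ∃ k : ℤ, (k : ZMod ℓ) = x i ∧ 2 * m + 1 - ℓ < 2 * k ∧ 2 * k < 2 * m + 1}

/-- The sites with `ε < x_i < ε + ℓ/2` modulo `ℓ`, where `ε = m + 1/2`. -/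
def rightHalf {d : ℕ} (ℓ : ℕ) (i : Fin d) (m : ℤ) : Set (Box d ℓ) :=
  {x | ∃ k : ℤ, (k : ZMod ℓ) = x i ∧ 2 * m + 1 < 2 * k ∧ 2 * k < 2 * m + 1 + ℓ}

theorem isCompl_halves {d ℓ : ℕ} (hℓ : 0 < ℓ) (he : Even ℓ) (i : Fin d) (m : ℤ) :
    IsCompl (leftHalf ℓ i m) (rightHalf ℓ i m) := by
  have : NeZero ℓ := ⟨hℓ.ne'⟩
  obtain ⟨r, hr⟩ := he
  refine ⟨Set.disjoint_left.2 ?_, codisjoint_iff_le_sup.2 ?_⟩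
  · rintro x ⟨k, hk, h1, h2⟩ ⟨k', hk', h3, h4⟩
    have h := (ZMod.intCast_eq_intCast_iff_dvd_sub k k' ℓ).1 (hk.trans hk'.symm)
    have := Int.le_of_dvd (by lia) h
    lia
  · intro x _
    obtain ⟨k, hk⟩ := ZMod.intCast_surjective (x i)
    have hl : (0 : ℤ) < ℓ := by exact_mod_cast hℓ
    have h1 := Int.emod_nonneg (k - (m + 1 - r)) hl.ne'
    have h2 := Int.emod_lt_of_pos (k - (m + 1 - r)) hl
    have hc : (((m + 1 - r) + (k - (m + 1 - r)) % ℓ : ℤ) : ZMod ℓ) = x i := by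
      rw [← hk, ZMod.intCast_eq_intCast_iff_dvd_sub]
      have := Int.emod_add_mul_ediv (k - (m + 1 - r)) ℓ
      exact ⟨(k - (m + 1 - r)) / ℓ, by linarith⟩
    generalize (k - (m + 1 - r)) % (ℓ : ℤ) = q at *
    by_cases hq : q < r
    · exact Or.inl ⟨_, hc, by lia, by lia⟩
    · exact Or.inr ⟨_, hc, by lia, by lia⟩

theorem reflect_mem_left {d ℓ : ℕ} {i : Fin d} {m : ℤ} {x : Box d ℓ}
    (hx : x ∈ rightHalf ℓ i m) : reflect i m x ∈ leftHalf ℓ i m := by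
  obtain ⟨k, hk, h1, h2⟩ := hx
  exact ⟨2 * m + 1 - k, by simp [reflect, hk], by lia, by lia⟩

theorem reflect_mem_right {d ℓ : ℕ} {i : Fin d} {m : ℤ} {x : Box d ℓ}
    (hx : x ∈ leftHalf ℓ i m) : reflect i m x ∈ rightHalf ℓ i m := by
  obtain ⟨k, hk, h1, h2⟩ := hx
  exact ⟨2 * m + 1 - k, by simp [reflect, hk], by lia, by lia⟩

/-- The reflected field `(R v₁)_x = (v₁)_{R x}` on the right half of a field on the left half. -/
def reflectToRight {d ℓ : ℕ} {i : Fin d} {m : ℤ} (v₁ : leftHalf ℓ i m → ℝ) :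
    rightHalf ℓ i m → ℝ :=
  fun x => v₁ ⟨reflect i m x, reflect_mem_left x.2⟩

/-- The reflected field `(R v₂)_x = (v₂)_{R x}` on the left half of a field on the right half. -/
def reflectToLeft {d ℓ : ℕ} {i : Fin d} {m : ℤ} (v₂ : rightHalf ℓ i m → ℝ) :
    leftHalf ℓ i m → ℝ :=
  fun x => v₂ ⟨reflect i m x, reflect_mem_right x.2⟩

open Classical in
/-- The field `(v₁, v₂)` on the box. For even `ℓ` the last case does not occur, see
`isCompl_halves`. -/
def glue {d ℓ : ℕ} {i : Fin d} {m : ℤ} (v₁ : leftHalf ℓ i m → ℝ) (v₂ : rightHalf ℓ i m → ℝ) :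
    Box d ℓ → ℝ :=
  fun x => if h : x ∈ leftHalf ℓ i m then v₁ ⟨x, h⟩
    else if h' : x ∈ rightHalf ℓ i m then v₂ ⟨x, h'⟩ else 0

end SpinRP

end

/-!
# Schwarz inequality for reflections of the quantum Heisenberg partition function

Completing the square turns `-β H(v)` together with the factor `exp (β (v, Δ v) / 4)` into the pair
interaction of the shifted spins `S⁽³⁾ + v / 2`, up to terms on single sites, whose coefficients do
not change under the reflection (`modifiedPartitionFunction_eq`). The matrices of `S⁽¹⁾`, `i S⁽²⁾`
and `S⁽³⁾` are real, and the factor `i` turns `J⁽²⁾` into `-J⁽²⁾`. So `Z̃(v)` is the trace of the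
exponential of a real matrix `A ⊗ 1 + 1 ⊗ B + ∑ C ⊗ D` on the tensor product of the two halves of
the box, provided that the couplings between the halves are positive semidefinite.

For `∑ C ⊗ D` alone, the trace of a power is a sum over words of products of two real traces, and
the claim is the Cauchy-Schwarz inequality. The terms `A ⊗ 1 + 1 ⊗ B` are the limit of
`(√t A + 1/√t) ⊗ (√t B + 1/√t) - 1/t` as `t → 0` (`trace_exp_kronecker_sum_sq_le`).

It remains to see that the periodised couplings between the halves are positive semidefinite.

* Except for the walks, the couplings are reflection positive on `ℤ ^ d`. The nearest-neighbour
  coupling joins mirror images only. The Yukawa coupling is a product over the coordinates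
  (`isReflectionPositive_exp_neg_l1norm`). The power law is a superposition of Yukawa couplings. The
  Euclidean power law is a superposition of functions `cos (k · p) exp (-κ r)`, where `r` is the
  coordinate across the plane and `p` are the others (`isReflectionPositive_l2norm_rpow`).
* Reflection positivity passes to the torus (`IsReflectionPositive.periodise`): across the plane,
  the images are copies of the slab in the half space, and along the plane, the sum over the images
  is a limit of averages over the differences of the points of a cube.
* The sum over walks is the Green function `(1 - T)⁻¹` of the hopping operator `T`, on `ℤ ^ d` and,
  periodised, on the torus. There `⟨F, (1 - T)⁻¹ F'⟩ ≥ 0` for a source `F` on the left half and its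
  mirror image `F'`, because the even source `F + F'` has at least the energy of the odd source
  `F - F'` by the variational principle (`dotProduct_le_of_even_odd`): changing the sign of the odd
  potential on one half only affects the bonds between mirror images, where its values are opposite.
-/

open Filter Topology MeasureTheory
open scoped Kronecker

namespace SpinRP

/-! ### Trace inequalities on tensor products -/

section TraceInequality

variable {ι κ : Type*} [Fintype ι] [DecidableEq ι] [Fintype κ]

/-- The product `E (w 0) * ⋯ * E (w (m - 1))` of a word `w` in the letters `E k`. -/
def wordProd {R : Type*} [Monoid R] (E : κ → R) {m : ℕ} (w : Fin m → κ) : R :=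
  (List.ofFn fun j => E (w j)).prod

theorem sum_kronecker_pow (E F : κ → Matrix ι ι ℝ) (m : ℕ) :
    (∑ k, E k ⊗ₖ F k) ^ m = ∑ w : Fin m → κ, wordProd E w ⊗ₖ wordProd F w := by
  induction m with
  | zero => simp [wordProd]
  | succ m ih =>
    rw [pow_succ', ih, ← (Fin.consEquiv fun _ => κ).sum_comp, Fintype.sum_prod_type,
      Finset.sum_mul_sum]
    refine Finset.sum_congr rfl fun k _ => Finset.sum_congr rfl fun w _ => ?_
    simp [wordProd, Fin.consEquiv, Matrix.mul_kronecker_mul]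

/-- The trace of a power is a sum over words of products `Tr E_w Tr F_w`. For real matrices, this is
a scalar product. -/
theorem trace_pow_kronecker_sq_le (E F : κ → Matrix ι ι ℝ) (m : ℕ) :
    ((∑ k, E k ⊗ₖ F k) ^ m).trace ^ 2 ≤
      ((∑ k, E k ⊗ₖ E k) ^ m).trace * ((∑ k, F k ⊗ₖ F k) ^ m).trace := by
  simp only [sum_kronecker_pow, Matrix.trace_sum, Matrix.trace_kronecker, ← pow_two]
  exact Finset.sum_mul_sq_le_sq_mul_sq _ _ _

theorem trace_pow_kronecker_self_nonneg (E : κ → Matrix ι ι ℝ) (m : ℕ) :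
    0 ≤ ((∑ k, E k ⊗ₖ E k) ^ m).trace := by
  simp only [sum_kronecker_pow, Matrix.trace_sum, Matrix.trace_kronecker]
  exact Finset.sum_nonneg fun w _ => mul_self_nonneg _

theorem hasSum_trace_exp (M : Matrix ι ι ℝ) :
    HasSum (fun m : ℕ => ((m.factorial : ℝ)⁻¹) * (M ^ m).trace) (NormedSpace.exp M).trace := by
  let _ : NormedRing (Matrix ι ι ℝ) := Matrix.linftyOpNormedRing
  let _ : NormedAlgebra ℝ (Matrix ι ι ℝ) := Matrix.linftyOpNormedAlgebra
  let _ : NormedAlgebra ℚ (Matrix ι ι ℝ) := NormedAlgebra.restrictScalars ℚ ℝ _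
  have h := NormedSpace.exp_series_hasSum_exp' (𝕂 := ℝ) M
  have h' := h.map (Matrix.traceAddMonoidHom ι ℝ) (by
    show Continuous fun M : Matrix ι ι ℝ => M.trace
    fun_prop)
  simp only [Function.comp_def, Matrix.traceAddMonoidHom_apply, Matrix.trace_smul,
    smul_eq_mul] at h'
  exact h'

theorem continuous_trace_exp : Continuous fun M : Matrix ι ι ℝ => (NormedSpace.exp M).trace := by
  let _ : NormedRing (Matrix ι ι ℝ) := Matrix.linftyOpNormedRing
  let _ : NormedAlgebra ℝ (Matrix ι ι ℝ) := Matrix.linftyOpNormedAlgebra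
  let _ : NormedAlgebra ℚ (Matrix ι ι ℝ) := NormedAlgebra.restrictScalars ℚ ℝ _
  exact Continuous.matrix_trace NormedSpace.exp_continuous

theorem exp_mul_trace_exp {ι : Type*} [Fintype ι] [DecidableEq ι] (c : ℝ) (M : Matrix ι ι ℝ) :
    Real.exp c * (NormedSpace.exp M).trace = (NormedSpace.exp (M + c • 1)).trace := by
  have h : NormedSpace.exp (c • (1 : Matrix ι ι ℝ)) = Real.exp c • (1 : Matrix ι ι ℝ) := by
    rw [← Matrix.diagonal_one, ← Matrix.diagonal_smul, Matrix.exp_diagonal, ← Matrix.diagonal_smul]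
    congr 1
    funext j
    rw [Pi.coe_exp]
    simp [Real.exp_eq_exp_ℝ]
  rw [Matrix.exp_add_of_commute _ _ ((Commute.one_right _).smul_right _), h]
  simp

/-- The inequality for tensor products, from the Cauchy-Schwarz inequality for each power in the
exponential series. -/
theorem trace_exp_kronecker_sq_le (E F : κ → Matrix ι ι ℝ) :
    (NormedSpace.exp (∑ k, E k ⊗ₖ F k)).trace ^ 2 ≤
      (NormedSpace.exp (∑ k, E k ⊗ₖ E k)).trace * (NormedSpace.exp (∑ k, F k ⊗ₖ F k)).trace := by
  refine le_of_tendsto_of_tendsto' ((hasSum_trace_exp _).tendsto_sum_nat.pow 2)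
    ((hasSum_trace_exp _).tendsto_sum_nat.mul (hasSum_trace_exp _).tendsto_sum_nat) fun N => ?_
  refine Finset.sum_sq_le_sum_mul_sum_of_sq_le_mul _ (fun m _ => ?_) (fun m _ => ?_) fun m _ => ?_
  · exact mul_nonneg (by positivity) (trace_pow_kronecker_self_nonneg E m)
  · exact mul_nonneg (by positivity) (trace_pow_kronecker_self_nonneg F m)
  · have := mul_le_mul_of_nonneg_left (trace_pow_kronecker_sq_le E F m)
      (sq_nonneg ((m.factorial : ℝ)⁻¹))
    linarith

/-- The inequality with additional operators `A`, `B` on the two factors. They are made part of a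
tensor product `(√t A + 1/√t) ⊗ (√t B + 1/√t)`, where the additional term `t A ⊗ B` vanishes as
`t → 0`, and `1/t` contributes the same factor to both sides of the inequality. -/
theorem trace_exp_kronecker_sum_sq_le (A B : Matrix ι ι ℝ) (C D : κ → Matrix ι ι ℝ) :
    (NormedSpace.exp (A ⊗ₖ 1 + 1 ⊗ₖ B + ∑ k, C k ⊗ₖ D k)).trace ^ 2 ≤
      (NormedSpace.exp (A ⊗ₖ 1 + 1 ⊗ₖ A + ∑ k, C k ⊗ₖ C k)).trace *
        (NormedSpace.exp (B ⊗ₖ 1 + 1 ⊗ₖ B + ∑ k, D k ⊗ₖ D k)).trace := by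
  have key : ∀ (t : ℝ), 0 < t → ∀ (A B : Matrix ι ι ℝ) (C D : κ → Matrix ι ι ℝ),
      (NormedSpace.exp (∑ k : Option κ, (k.elim (√t • A + (√t)⁻¹ • 1) C) ⊗ₖ
        (k.elim (√t • B + (√t)⁻¹ • 1) D))).trace =
      Real.exp t⁻¹ * (NormedSpace.exp (A ⊗ₖ 1 + 1 ⊗ₖ B + ∑ k, C k ⊗ₖ D k +
        t • A ⊗ₖ B)).trace := by
    intro t ht A B C D
    have h1 : √t * (√t)⁻¹ = 1 := mul_inv_cancel₀ (Real.sqrt_pos.2 ht).ne'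
    have h2 : √t * √t = t := Real.mul_self_sqrt ht.le
    have h3 : (√t)⁻¹ * (√t)⁻¹ = t⁻¹ := by rw [← mul_inv, h2]
    have h4 : ∑ k : Option κ, (k.elim (√t • A + (√t)⁻¹ • 1) C) ⊗ₖ
        (k.elim (√t • B + (√t)⁻¹ • 1) D) =
        t⁻¹ • (1 : Matrix (ι × ι) (ι × ι) ℝ) +
          (A ⊗ₖ 1 + 1 ⊗ₖ B + ∑ k, C k ⊗ₖ D k + t • A ⊗ₖ B) := by
      simp only [Fintype.sum_option, Option.elim_none, Option.elim_some, Matrix.add_kronecker,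
        Matrix.kronecker_add, Matrix.smul_kronecker, Matrix.kronecker_smul, smul_add, smul_smul, h1,
        h2, h3, mul_comm (√t)⁻¹, one_smul, Matrix.one_kronecker_one]
      abel
    rw [h4, add_comm, ← exp_mul_trace_exp]
  have lim : ∀ (A B : Matrix ι ι ℝ) (C D : κ → Matrix ι ι ℝ),
      Tendsto (fun t : ℝ => (NormedSpace.exp (A ⊗ₖ 1 + 1 ⊗ₖ B + ∑ k, C k ⊗ₖ D k +
        t • A ⊗ₖ B)).trace) (𝓝[>] 0)
        (𝓝 (NormedSpace.exp (A ⊗ₖ 1 + 1 ⊗ₖ B + ∑ k, C k ⊗ₖ D k)).trace) := by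
    intro A B C D
    have hc : Continuous fun t : ℝ => (NormedSpace.exp (A ⊗ₖ 1 + 1 ⊗ₖ B + ∑ k, C k ⊗ₖ D k +
        t • A ⊗ₖ B)).trace :=
      continuous_trace_exp.comp (by fun_prop)
    simpa using (hc.tendsto 0).mono_left nhdsWithin_le_nhds
  refine le_of_tendsto_of_tendsto ((lim A B C D).pow 2) ((lim A A C C).mul (lim B B D D)) ?_
  filter_upwards [self_mem_nhdsWithin] with t ht
  have h := trace_exp_kronecker_sq_le (fun k : Option κ => k.elim (√t • A + (√t)⁻¹ • 1) C)
    (fun k : Option κ => k.elim (√t • B + (√t)⁻¹ • 1) D)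
  rw [key t ht, key t ht, key t ht] at h
  have he : 0 < Real.exp t⁻¹ ^ 2 := by positivity
  refine le_of_mul_le_mul_left ?_ he
  linarith

/-- The inequality for couplings between the factors given by positive semidefinite matrices. -/
theorem trace_exp_posSemidef_sq_le {Λ α : Type*} [Fintype Λ] [Fintype α]
    (M : α → Matrix Λ Λ ℝ) (hM : ∀ i, (M i).PosSemidef) (A B : Matrix ι ι ℝ)
    (C D : α → Λ → Matrix ι ι ℝ) :
    (NormedSpace.exp (A ⊗ₖ 1 + 1 ⊗ₖ B + ∑ i, ∑ x, ∑ y, M i x y • C i x ⊗ₖ D i y)).trace ^ 2 ≤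
      (NormedSpace.exp (A ⊗ₖ 1 + 1 ⊗ₖ A + ∑ i, ∑ x, ∑ y, M i x y • C i x ⊗ₖ C i y)).trace *
      (NormedSpace.exp (B ⊗ₖ 1 + 1 ⊗ₖ B + ∑ i, ∑ x, ∑ y, M i x y • D i x ⊗ₖ D i y)).trace := by
  classical
  choose r a ha using fun i => Matrix.posSemidef_iff_eq_sum_vecMulVec.1 (hM i)
  have key : ∀ C D : α → Λ → Matrix ι ι ℝ,
      ∑ i, ∑ x, ∑ y, M i x y • C i x ⊗ₖ D i y =
        ∑ k : (i : α) × Fin (r i),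
          (∑ x, a k.1 k.2 x • C k.1 x) ⊗ₖ (∑ y, a k.1 k.2 y • D k.1 y) := by
    intro C D
    rw [Fintype.sum_sigma]
    refine Finset.sum_congr rfl fun i _ => ?_
    have : ∀ x y, M i x y = ∑ k, a i k x * a i k y := by
      intro x y
      conv_lhs => rw [ha i]
      simp [Matrix.sum_apply, Matrix.vecMulVec_apply]
    ext p q
    simp only [this, Matrix.sum_apply, Matrix.smul_apply, Matrix.kroneckerMap_apply, smul_eq_mul,
      Finset.sum_mul, Finset.mul_sum]
    conv_lhs => enter [2, x]; rw [Finset.sum_comm]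
    rw [Finset.sum_comm]
    refine Finset.sum_congr rfl fun k _ => ?_
    rw [Finset.sum_comm]
    refine Finset.sum_congr rfl fun x _ => Finset.sum_congr rfl fun y _ => ?_
    ring
  rw [key, key, key]
  exact trace_exp_kronecker_sum_sq_le A B _ _

end TraceInequality

/-! ### Pair interactions on two copies of a set of sites -/

section Sites

variable {X Λ : Type*} {n : ℕ}

open Classical in
/-- The real analogue of `siteOperator`, over an arbitrary set of sites: the operator that acts as
`a` at the site `x` and as the identity at all other sites. -/
noncomputable def localOp (x : X) (a : Matrix (Fin n) (Fin n) ℝ) :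
    Matrix (X → Fin n) (X → Fin n) ℝ :=
  Matrix.of fun σ τ => if ∀ y, y ≠ x → σ y = τ y then a (σ x) (τ x) else 0

theorem localOp_add (x : X) (a b : Matrix (Fin n) (Fin n) ℝ) :
    localOp x (a + b) = localOp x a + localOp x b := by
  ext σ τ
  simp only [localOp, Matrix.of_apply, Matrix.add_apply]
  split_ifs <;> simp

theorem localOp_smul (x : X) (c : ℝ) (a : Matrix (Fin n) (Fin n) ℝ) :
    localOp x (c • a) = c • localOp x a := by
  ext σ τ
  simp only [localOp, Matrix.of_apply, Matrix.smul_apply]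
  split_ifs <;> simp

theorem localOp_one [Fintype X] [DecidableEq X] (x : X) :
    localOp x (1 : Matrix (Fin n) (Fin n) ℝ) = 1 := by
  ext σ τ
  simp only [localOp, Matrix.of_apply, Matrix.one_apply]
  by_cases h : σ = τ
  · simp [h]
  · rw [if_neg h]
    split_ifs with h1 h2
    · exact absurd (funext fun y => if hy : y = x then hy ▸ h2 else h1 y hy) h
    · rfl
    · rfl

/-- A configuration on the sites `X ≃ Λ ⊕ Λ` as a pair of configurations on `Λ`. -/
def splitConfig (φ : Λ ⊕ Λ ≃ X) : (X → Fin n) ≃ (Λ → Fin n) × (Λ → Fin n) :=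
  (φ.symm.arrowCongr (Equiv.refl _)).trans (Equiv.sumArrowEquivProdArrow _ _ _)

theorem splitConfig_symm_apply (φ : Λ ⊕ Λ ≃ X) (σ : (Λ → Fin n) × (Λ → Fin n)) (p : Λ ⊕ Λ) :
    (splitConfig φ).symm σ (φ p) = Sum.elim σ.1 σ.2 p := by
  simp [splitConfig, Equiv.sumArrowEquivProdArrow, Equiv.arrowCongr]

theorem reindex_localOp_inl [Fintype Λ] [DecidableEq Λ] (φ : Λ ⊕ Λ ≃ X) (x : Λ)
    (a : Matrix (Fin n) (Fin n) ℝ) :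
    Matrix.reindex (splitConfig φ) (splitConfig φ) (localOp (φ (.inl x)) a) =
      localOp x a ⊗ₖ 1 := by
  ext ⟨σ₁, σ₂⟩ ⟨τ₁, τ₂⟩
  simp only [localOp, Matrix.reindex_apply, Matrix.submatrix_apply, Matrix.of_apply,
    Matrix.kroneckerMap_apply]
  rw [← φ.forall_congr_right]
  simp only [splitConfig_symm_apply, Sum.forall, Sum.elim_inl, Sum.elim_inr, ne_eq,
    EmbeddingLike.apply_eq_iff_eq, Sum.inl.injEq, reduceCtorEq, not_false_eq_true, forall_const,
    ← funext_iff (f := σ₂) (g := τ₂)]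
  by_cases h : σ₂ = τ₂ <;> simp [h, Matrix.one_apply]

theorem reindex_localOp_inr [Fintype Λ] [DecidableEq Λ] (φ : Λ ⊕ Λ ≃ X) (x : Λ)
    (a : Matrix (Fin n) (Fin n) ℝ) :
    Matrix.reindex (splitConfig φ) (splitConfig φ) (localOp (φ (.inr x)) a) =
      1 ⊗ₖ localOp x a := by
  ext ⟨σ₁, σ₂⟩ ⟨τ₁, τ₂⟩
  simp only [localOp, Matrix.reindex_apply, Matrix.submatrix_apply, Matrix.of_apply,
    Matrix.kroneckerMap_apply]
  rw [← φ.forall_congr_right]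
  simp only [splitConfig_symm_apply, Sum.forall, Sum.elim_inl, Sum.elim_inr, ne_eq,
    EmbeddingLike.apply_eq_iff_eq, Sum.inr.injEq, reduceCtorEq, not_false_eq_true, forall_const,
    ← funext_iff (f := σ₁) (g := τ₁)]
  by_cases h : σ₁ = τ₁ <;> simp [h, Matrix.one_apply]

variable [Fintype X] [DecidableEq X] [Fintype Λ] [DecidableEq Λ]

theorem trace_exp_reindex {ι ι' : Type*} [Fintype ι] [DecidableEq ι] [Fintype ι'] [DecidableEq ι']
    (e : ι ≃ ι') (M : Matrix ι ι ℝ) :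
    (NormedSpace.exp (Matrix.reindexAlgEquiv ℝ ℝ e M)).trace = (NormedSpace.exp M).trace := by
  refine (hasSum_trace_exp _).unique ?_
  convert hasSum_trace_exp M using 3 with m
  rw [← map_pow]
  simp [Matrix.trace, Matrix.coe_reindexAlgEquiv, Equiv.sum_comp e.symm fun i => (M ^ m) i i]

variable {α : Type*} [Fintype α]

/-- The operator `∑_i ∑_{x,y} K i x y • T_x T_y - ∑_x g_x`, where `T_x` acts as `t i (v x)` at the
site `x` and `g_x` as `g x (v x)`. -/
noncomputable def pairOp (K : α → X → X → ℝ) (t : α → ℝ → Matrix (Fin n) (Fin n) ℝ)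
    (g : X → ℝ → Matrix (Fin n) (Fin n) ℝ) (v : X → ℝ) : Matrix (X → Fin n) (X → Fin n) ℝ :=
  ∑ i, ∑ x, ∑ y, K i x y • (localOp x (t i (v x)) * localOp y (t i (v y))) -
    ∑ x, localOp x (g x (v x))

/-- Across the bipartition of the sites, `pairOp` splits into equal operators on the two halves and
a coupling between them. -/
theorem reindex_pairOp (φ : Λ ⊕ Λ ≃ X) (K : α → X → X → ℝ)
    (t : α → ℝ → Matrix (Fin n) (Fin n) ℝ) (g : X → ℝ → Matrix (Fin n) (Fin n) ℝ)
    (hsymm : ∀ i x y, K i x y = K i y x)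
    (hK : ∀ i a b, K i (φ (.inr a)) (φ (.inr b)) = K i (φ (.inl a)) (φ (.inl b)))
    (hg : ∀ a, g (φ (.inr a)) = g (φ (.inl a))) (u₁ u₂ : Λ → ℝ) (v : X → ℝ)
    (hv : ∀ p, v (φ p) = Sum.elim u₁ u₂ p) :
    Matrix.reindexAlgEquiv ℝ ℝ (splitConfig φ) (pairOp K t g v) =
      pairOp (fun i a b => K i (φ (.inl a)) (φ (.inl b))) t (fun a => g (φ (.inl a))) u₁ ⊗ₖ 1 +
      1 ⊗ₖ pairOp (fun i a b => K i (φ (.inl a)) (φ (.inl b))) t (fun a => g (φ (.inl a))) u₂ +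
      ∑ i, ∑ a, ∑ b, (2 * K i (φ (.inl a)) (φ (.inr b))) •
        localOp a (t i (u₁ a)) ⊗ₖ localOp b (t i (u₂ b)) := by
  have hl := fun x a => reindex_localOp_inl (n := n) φ x a
  have hr := fun x a => reindex_localOp_inr (n := n) φ x a
  simp only [← Matrix.coe_reindexAlgEquiv ℝ ℝ] at hl hr
  have hA : ∀ u : Λ → ℝ,
      pairOp (fun i a b => K i (φ (.inl a)) (φ (.inl b))) t (fun a => g (φ (.inl a))) u ⊗ₖ
        (1 : Matrix (Λ → Fin n) (Λ → Fin n) ℝ) =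
      ∑ i, ∑ a, ∑ b, K i (φ (.inl a)) (φ (.inl b)) •
        ((localOp a (t i (u a)) * localOp b (t i (u b))) ⊗ₖ 1) -
        ∑ a, localOp a (g (φ (.inl a)) (u a)) ⊗ₖ 1 := by
    intro u
    ext p q
    simp [pairOp, Matrix.sum_apply, Finset.sum_mul, sub_mul, mul_assoc]
  have hB : ∀ u : Λ → ℝ,
      (1 : Matrix (Λ → Fin n) (Λ → Fin n) ℝ) ⊗ₖ
        pairOp (fun i a b => K i (φ (.inl a)) (φ (.inl b))) t (fun a => g (φ (.inl a))) u =
      ∑ i, ∑ a, ∑ b, K i (φ (.inl a)) (φ (.inl b)) •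
        (1 ⊗ₖ (localOp a (t i (u a)) * localOp b (t i (u b)))) -
        ∑ a, 1 ⊗ₖ localOp a (g (φ (.inl a)) (u a)) := by
    intro u
    ext p q
    simp [pairOp, Matrix.sum_apply, Finset.mul_sum, mul_sub, mul_left_comm]
  have hC : ∀ i, ∑ a, ∑ b, K i (φ (.inr a)) (φ (.inl b)) •
      localOp b (t i (u₁ b)) ⊗ₖ localOp a (t i (u₂ a)) =
      ∑ a, ∑ b, K i (φ (.inl a)) (φ (.inr b)) •
        localOp a (t i (u₁ a)) ⊗ₖ localOp b (t i (u₂ b)) := by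
    intro i
    rw [Finset.sum_comm]
    simp only [hsymm i (φ (.inr _)) (φ (.inl _))]
  rw [hA, hB]
  simp only [pairOp, map_sub, map_add, map_sum, map_smul, map_mul, ← φ.sum_comp,
    Fintype.sum_sum_type, hv, Sum.elim_inl, Sum.elim_inr, hl, hr, hK, hg,
    ← Matrix.mul_kronecker_mul, one_mul, mul_one, Finset.sum_add_distrib, hC, two_mul, add_smul]
  abel

/-- Reflection positivity of a pair interaction: if the sites are two copies of `Λ`, the couplings
and the local terms are the same on both, and the couplings between the two copies form positive
semidefinite matrices, then `Tr exp` obeys the Schwarz inequality for the reflection. -/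
theorem trace_exp_pairOp_sq_le (φ : Λ ⊕ Λ ≃ X) (K : α → X → X → ℝ)
    (t : α → ℝ → Matrix (Fin n) (Fin n) ℝ) (g : X → ℝ → Matrix (Fin n) (Fin n) ℝ)
    (hsymm : ∀ i x y, K i x y = K i y x)
    (hK : ∀ i a b, K i (φ (.inr a)) (φ (.inr b)) = K i (φ (.inl a)) (φ (.inl b)))
    (hg : ∀ a, g (φ (.inr a)) = g (φ (.inl a)))
    (hpos : ∀ i, (Matrix.of fun a b => K i (φ (.inl a)) (φ (.inr b))).PosSemidef)
    (u₁ u₂ : Λ → ℝ) (v w₁ w₂ : X → ℝ) (hv : ∀ p, v (φ p) = Sum.elim u₁ u₂ p)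
    (hw₁ : ∀ p, w₁ (φ p) = Sum.elim u₁ u₁ p) (hw₂ : ∀ p, w₂ (φ p) = Sum.elim u₂ u₂ p) :
    (NormedSpace.exp (pairOp K t g v)).trace ^ 2 ≤
      (NormedSpace.exp (pairOp K t g w₁)).trace * (NormedSpace.exp (pairOp K t g w₂)).trace := by
  rw [← trace_exp_reindex (splitConfig φ), ← trace_exp_reindex (splitConfig φ),
    ← trace_exp_reindex (splitConfig φ),
    reindex_pairOp φ K t g hsymm hK hg u₁ u₂ v hv, reindex_pairOp φ K t g hsymm hK hg u₁ u₁ w₁ hw₁,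
    reindex_pairOp φ K t g hsymm hK hg u₂ u₂ w₂ hw₂]
  exact trace_exp_posSemidef_sq_le
    (fun i => Matrix.of fun a b => 2 * K i (φ (.inl a)) (φ (.inr b)))
    (fun i => (hpos i).smul (zero_le_two (α := ℝ))) _ _
    (fun i a => localOp a (t i (u₁ a))) fun i b => localOp b (t i (u₂ b))

end Sites

/-! ### The partition function with real matrices -/

section RealForm

/-- The raising operator as a real matrix. -/
noncomputable def realSpinRaise (n : ℕ) : Matrix (Fin n) (Fin n) ℝ :=
  Matrix.of fun j k => if (j : ℕ) + 1 = k then √((k : ℝ) * ((n : ℝ) - k)) else 0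

/-- The real matrices `S⁽¹⁾, i S⁽²⁾, S⁽³⁾`. -/
noncomputable def realSpinMatrix (n : ℕ) : Fin 3 → Matrix (Fin n) (Fin n) ℝ :=
  ![(1 / 2 : ℝ) • (realSpinRaise n + (realSpinRaise n).transpose),
    (1 / 2 : ℝ) • (realSpinRaise n - (realSpinRaise n).transpose),
    Matrix.diagonal fun k => ((n : ℝ) - 1) / 2 - (k : ℕ)]

/-- The signs `1, -1, 1` of the squares of the phases in `S⁽¹⁾, i S⁽²⁾, S⁽³⁾`. -/
def spinSign : Fin 3 → ℝ := ![1, -1, 1]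

/-- The phases `1, -i, 1` that turn the real matrices into the spin matrices. -/
noncomputable def spinPhase : Fin 3 → ℂ := ![1, -Complex.I, 1]

theorem spinPhase_mul_self (i : Fin 3) : spinPhase i * spinPhase i = (spinSign i : ℂ) := by
  fin_cases i <;> simp [spinPhase, spinSign]

theorem spinRaise_eq_map (n : ℕ) : spinRaise n = (realSpinRaise n).map Complex.ofReal := by
  ext j k
  simp only [spinRaise, realSpinRaise, Matrix.of_apply, Matrix.map_apply]
  split_ifs <;> simp

theorem spinMatrix_eq (n : ℕ) (i : Fin 3) :
    spinMatrix n i = spinPhase i • (realSpinMatrix n i).map Complex.ofReal := by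
  have hI : (1 / (2 * Complex.I) : ℂ) = -Complex.I * (1 / 2) := by
    rw [one_div, mul_inv, Complex.inv_I]; ring
  fin_cases i
  · ext j k
    simp [spinMatrix, spinPhase, realSpinMatrix, spinRaise_eq_map]
  · ext j k
    simp only [spinMatrix, spinPhase, realSpinMatrix, spinRaise_eq_map, hI]
    simp [mul_assoc]
  · ext j k
    simp only [spinMatrix, spinPhase, realSpinMatrix]
    by_cases h : j = k <;> simp [h]

variable {d ℓ n : ℕ}

theorem spin_eq [NeZero ℓ] (i : Fin 3) (x : Box d ℓ) :
    spin n i x = spinPhase i • (localOp x (realSpinMatrix n i)).map Complex.ofReal := by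
  ext σ τ
  simp only [spin, siteOperator, localOp, spinMatrix_eq, Matrix.of_apply, Matrix.smul_apply,
    Matrix.map_apply]
  split_ifs <;> simp

theorem trace_exp_map_ofReal {ι : Type*} [Fintype ι] [DecidableEq ι] (M : Matrix ι ι ℝ) :
    (NormedSpace.exp (M.map Complex.ofReal)).trace = ((NormedSpace.exp M).trace : ℂ) := by
  let _ : NormedRing (Matrix ι ι ℝ) := Matrix.linftyOpNormedRing
  let _ : NormedAlgebra ℝ (Matrix ι ι ℝ) := Matrix.linftyOpNormedAlgebra
  let _ : NormedAlgebra ℚ (Matrix ι ι ℝ) := NormedAlgebra.restrictScalars ℚ ℝ _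
  let _ : NormedRing (Matrix ι ι ℂ) := Matrix.linftyOpNormedRing
  let _ : NormedAlgebra ℝ (Matrix ι ι ℂ) := Matrix.linftyOpNormedAlgebra
  let _ : NormedAlgebra ℚ (Matrix ι ι ℂ) := NormedAlgebra.restrictScalars ℚ ℝ _
  have h := NormedSpace.map_exp (Complex.ofRealHom.mapMatrix (m := ι))
    (by
      show Continuous fun M : Matrix ι ι ℝ => M.map Complex.ofReal
      exact continuous_id.matrix_map Complex.continuous_ofReal) M
  have h2 : (NormedSpace.exp (M.map Complex.ofReal)) = (NormedSpace.exp M).map Complex.ofReal :=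
    h.symm
  rw [h2]
  simp [Matrix.trace]

/-- The spin matrix `i`, where `S⁽³⁾` is shifted by half of the local value `u` of the field. -/
noncomputable def shiftedSpin (n : ℕ) (i : Fin 3) (u : ℝ) : Matrix (Fin n) (Fin n) ℝ :=
  realSpinMatrix n i + (if i = 2 then u / 2 else 0) • 1

/-- The partition function as the trace of the exponential of a real matrix. -/
theorem partitionFunction_eq [NeZero ℓ] (J : Fin 3 → (Fin d → ℤ) → ℝ) (β : ℝ) (v : Box d ℓ → ℝ) :
    partitionFunction n J β v =
      (NormedSpace.exp (∑ i, ∑ x, ∑ y, (β * (spinSign i * perCoupling (J i) x y)) •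
        (localOp x (realSpinMatrix n i) * localOp y (realSpinMatrix n i)) +
        ∑ x, (β * laplacian (J 2) v x) • localOp x (realSpinMatrix n 2))).trace := by
  have h : -(β : ℂ) • hamiltonian n J v =
      (∑ i, ∑ x, ∑ y, (β * (spinSign i * perCoupling (J i) x y)) •
        (localOp x (realSpinMatrix n i) * localOp y (realSpinMatrix n i)) +
        ∑ x, (β * laplacian (J 2) v x) • localOp x (realSpinMatrix n 2)).map Complex.ofReal := by
    have hmap : ∀ M : Matrix (Box d ℓ → Fin n) (Box d ℓ → Fin n) ℝ,
      M.map Complex.ofReal = Complex.ofRealHom.mapMatrix M := fun _ => rfl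
    have hsmul : ∀ (c : ℝ) (M : Matrix (Box d ℓ → Fin n) (Box d ℓ → Fin n) ℝ),
        Complex.ofRealHom.mapMatrix (c • M) = (c : ℂ) • Complex.ofRealHom.mapMatrix M := by
      intro c M; ext; simp
    have h2 : spinPhase 2 = 1 := rfl
    simp only [hamiltonian, spin_eq, hmap, map_add, map_sum, map_mul, hsmul, smul_mul_smul_comm,
      spinPhase_mul_self, h2, one_smul]
    rw [neg_smul, ← smul_neg, neg_sub, sub_neg_eq_add, add_comm, smul_add]
    simp only [Finset.smul_sum, smul_smul]
    push_cast
    simp only [mul_comm (spinSign _ : ℂ)]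
  rw [partitionFunction, h, trace_exp_map_ofReal, Complex.ofReal_re]

/-- Completing the square: the normalising factor turns the field term into a shift of `S⁽³⁾` by
half the field, up to terms that depend on one site only. -/
theorem modifiedPartitionFunction_eq [NeZero ℓ] (J : Fin 3 → (Fin d → ℤ) → ℝ) (β : ℝ)
    (hsymm : ∀ x y : Box d ℓ, perCoupling (J 2) x y = perCoupling (J 2) y x) (v : Box d ℓ → ℝ) :
    modifiedPartitionFunction n J β v =
      (NormedSpace.exp (pairOp (fun i x y => β * (spinSign i * perCoupling (J i) x y))
        (shiftedSpin n) (fun x u => (β * ∑ y, perCoupling (J 2) x y) •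
          (u • realSpinMatrix n 2 + (u ^ 2 / 4) • 1)) v)).trace := by
  rw [modifiedPartitionFunction, partitionFunction_eq, exp_mul_trace_exp]
  congr 2
  have h0 : shiftedSpin n 0 = fun _ => realSpinMatrix n 0 := by
    funext u; simp [shiftedSpin]
  have h1 : shiftedSpin n 1 = fun _ => realSpinMatrix n 1 := by
    funext u; simp [shiftedSpin]
  have h2 : ∀ (x : Box d ℓ) (u : ℝ), localOp x (shiftedSpin n 2 u) =
      localOp x (realSpinMatrix n 2) + (u / 2) • 1 := by
    intro x u
    simp [shiftedSpin, localOp_add, localOp_smul, localOp_one]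
  set S := fun x : Box d ℓ => localOp x (realSpinMatrix n 2) with hS
  have key : ∑ x, ∑ y, (β * perCoupling (J 2) x y) • ((S x + (v x / 2) • 1) * (S y + (v y / 2) • 1))
      - ∑ x, (β * ∑ y, perCoupling (J 2) x y) • (v x • S x + (v x ^ 2 / 4) • 1) =
      ∑ x, ∑ y, (β * perCoupling (J 2) x y) • (S x * S y) +
      ∑ x, (β * laplacian (J 2) v x) • S x + (β / 4 * ∑ x, v x * laplacian (J 2) v x) • 1 := by
    have e1 : ∑ x, ∑ y, (β * perCoupling (J 2) x y * (v x / 2)) • S y =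
        ∑ x, ∑ y, (β * perCoupling (J 2) x y * (v y / 2)) • S x := by
      rw [Finset.sum_comm]
      refine Finset.sum_congr rfl fun x _ => Finset.sum_congr rfl fun y _ => ?_
      rw [hsymm]
    have e2 : ∑ x, ∑ y, (β * perCoupling (J 2) x y) •
        ((S x + (v x / 2) • 1) * (S y + (v y / 2) • 1)) =
        ∑ x, ∑ y, (β * perCoupling (J 2) x y) • (S x * S y) +
        ∑ x, ∑ y, (β * perCoupling (J 2) x y * (v y / 2)) • S x +
        ∑ x, ∑ y, (β * perCoupling (J 2) x y * (v x / 2)) • S y +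
        ∑ x, ∑ y, (β * perCoupling (J 2) x y * (v x * v y / 4)) • 1 := by
      simp only [← Finset.sum_add_distrib]
      refine Finset.sum_congr rfl fun x _ => Finset.sum_congr rfl fun y _ => ?_
      simp only [add_mul, mul_add, smul_mul_assoc, mul_smul_comm, one_mul, mul_one]
      module
    rw [e2, e1]
    simp only [laplacian, Finset.mul_sum, Finset.sum_smul, ← Finset.sum_add_distrib,
      ← Finset.sum_sub_distrib]
    refine Finset.sum_congr rfl fun x _ => Finset.sum_congr rfl fun y _ => ?_
    module
  simp only [pairOp, Fin.sum_univ_three, h0, h1, h2, localOp_smul, localOp_add, localOp_one]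
  have hs : spinSign 2 = 1 := rfl
  simp only [hs, one_mul]
  rw [add_sub_assoc, key]
  abel

end RealForm

/-! ### Periodisation of reflection positive couplings -/

section Averaging

variable {J : Type*} [Fintype J] [DecidableEq J]

/-- The cube `{0, …, N - 1} ^ J` in `ℤ ^ J`. -/
noncomputable def cube (J : Type*) [Fintype J] [DecidableEq J] (N : ℕ) : Finset (J → ℤ) :=
  Fintype.piFinset fun _ => Finset.Ico (0 : ℤ) N

theorem card_cube (N : ℕ) : (cube J N).card = N ^ Fintype.card J := by
  simp [cube, Fintype.card_piFinset]

/-- The proportion of the sites of a cube that a translation keeps in the cube tends to one. -/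
theorem tendsto_cube_overlap (z : J → ℤ) :
    Tendsto (fun N : ℕ => (((cube J N).filter fun u => u - z ∈ cube J N).card : ℝ) /
      (cube J N).card) atTop (𝓝 1) := by
  have h1 : ∀ N : ℕ, (((cube J N).filter fun u => u - z ∈ cube J N).card : ℝ) =
      ∏ j, (((min (N : ℤ) (N + z j) - max 0 (z j)).toNat : ℕ) : ℝ) := by
    intro N
    have : (cube J N).filter (fun u => u - z ∈ cube J N) =
        Fintype.piFinset fun j => Finset.Ico (max 0 (z j)) (min (N : ℤ) (N + z j)) := by
      ext u
      simp only [cube, Finset.mem_filter, Fintype.mem_piFinset, Finset.mem_Ico, Pi.sub_apply,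
        ← forall_and]
      refine forall_congr' fun j => ?_
      lia
    rw [this, Fintype.card_piFinset]
    simp
  have h2 : ∀ N : ℕ, ((cube J N).card : ℝ) = ∏ _j : J, (N : ℝ) := by
    intro N
    simp [card_cube]
  simp only [h1, h2, ← Finset.prod_div_distrib]
  have h3 : (1 : ℝ) = ∏ _j : J, (1 : ℝ) := by simp
  rw [h3]
  refine tendsto_finsetProd _ fun j _ => ?_
  have h4 : Tendsto (fun N : ℕ => 1 - (|z j| : ℝ) / N) atTop (𝓝 (1 - 0)) :=
    tendsto_const_nhds.sub (tendsto_const_nhds.div_atTop tendsto_natCast_atTop_atTop)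
  rw [sub_zero] at h4
  refine h4.congr' ?_
  filter_upwards [eventually_ge_atTop ((z j).natAbs + 1)] with N hN
  have hN0 : (N : ℝ) ≠ 0 := by
    have : 0 < N := by lia
    positivity
  have h5 : ((min (N : ℤ) (N + z j) - max 0 (z j)).toNat : ℤ) = N - |z j| := by
    rcases abs_cases (z j) with h | h <;> lia
  have h6 : (((min (N : ℤ) (N + z j) - max 0 (z j)).toNat : ℕ) : ℝ) = N - |(z j : ℝ)| := by
    exact_mod_cast h5
  rw [h6]
  field_simp

/-- A summable function on `ℤ ^ J` whose sums over the differences of the points of each cube are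
nonnegative has a nonnegative sum: the normalised sums over differences converge to it. -/
theorem tsum_nonneg_of_sum_sub_nonneg (h : (J → ℤ) → ℝ) (hs : Summable h)
    (hpos : ∀ N, 0 ≤ ∑ u ∈ cube J N, ∑ u' ∈ cube J N, h (u - u')) : 0 ≤ ∑' z, h z := by
  have key : ∀ N, ∑ u ∈ cube J N, ∑ u' ∈ cube J N, h (u - u') =
      ∑' z, (((cube J N).filter fun u => u - z ∈ cube J N).card : ℝ) * h z := by
    intro N
    have h1 : ∀ u, ∑ u' ∈ cube J N, h (u - u') =
        ∑' z, if u - z ∈ cube J N then h z else 0 := by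
      intro u
      rw [← (Equiv.subLeft u).tsum_eq, tsum_eq_sum (s := cube J N)]
      · exact Finset.sum_congr rfl fun u' hu' => by simp [hu']
      · intro u' hu'
        simp [hu']
    have h2 : ∀ u ∈ cube J N, Summable fun z => if u - z ∈ cube J N then h z else 0 := by
      intro u _
      refine hs.norm.of_norm_bounded fun z => ?_
      split_ifs <;> simp
    simp only [h1]
    rw [← Summable.tsum_finsetSum h2]
    refine tsum_congr fun z => ?_
    rw [← Finset.sum_filter, Finset.sum_const, nsmul_eq_mul]
  have hlim : Tendsto (fun N : ℕ => ∑' z, (((cube J N).filter fun u => u - z ∈ cube J N).card : ℝ) /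
      (cube J N).card * h z) atTop (𝓝 (∑' z, h z)) := by
    refine tendsto_tsum_of_dominated_convergence hs.norm (fun z => ?_) (Eventually.of_forall ?_)
    · simpa using (tendsto_cube_overlap z).mul_const (h z)
    · intro N z
      rw [norm_mul]
      refine mul_le_of_le_one_left (norm_nonneg _) ?_
      rw [Real.norm_of_nonneg (by positivity)]
      exact div_le_one_of_le₀ (by exact_mod_cast Finset.card_filter_le _ _) (by positivity)
  refine ge_of_tendsto' hlim fun N => ?_
  simp only [div_mul_eq_mul_div, tsum_div_const, ← key]
  exact div_nonneg (hpos N) (by positivity)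

end Averaging

section Lattice

variable {d : ℕ}

/-- The difference `x - θ y`, where `θ` is the reflection that replaces `y_i` by `1 - y_i`. -/
def reflDiff (i : Fin d) (x y : Fin d → ℤ) : Fin d → ℤ :=
  Function.update (x - y) i (x i + y i - 1)

/-- Reflection positivity on `ℤ ^ d` across the plane `x_i = 1 / 2`, tested on points of the half
space `x_i ≥ 1`. -/
def IsReflectionPositive (i : Fin d) (K : (Fin d → ℤ) → ℝ) : Prop :=
  ∀ (ι : Type) [Fintype ι] (p : ι → Fin d → ℤ) (f : ι → ℝ), (∀ a, 1 ≤ p a i) →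
    0 ≤ ∑ a, ∑ b, f a * f b * K (reflDiff i (p a) (p b))

theorem injective_add_mul (ℓ : ℕ) [NeZero ℓ] (z : Fin d → ℤ) :
    Function.Injective fun w : Fin d → ℤ => z + fun j => (ℓ : ℤ) * w j := by
  intro w w' h
  funext j
  have := congrFun h j
  simp only [Pi.add_apply, add_right_inj] at this
  exact mul_left_cancel₀ (by exact_mod_cast NeZero.ne ℓ) this

/-- Periodisation preserves reflection positivity: on the torus of even side `2 r` the couplings
between the slab `1 ≤ x_i ≤ r` and its mirror image are positive semidefinite. -/
theorem IsReflectionPositive.periodise {i : Fin d} {K : (Fin d → ℤ) → ℝ}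
    (hK : IsReflectionPositive i K) (hs : Summable K)
    (heven : ∀ x, K (Function.update x i (-x i)) = K x) {Λ : Type} [Fintype Λ]
    {r : ℕ} (hr : 0 < r) (p : Λ → Fin d → ℤ) (hp : ∀ a, 1 ≤ p a i) (hp' : ∀ a, p a i ≤ r)
    (f : Λ → ℝ) :
    0 ≤ ∑ a, ∑ b, f a * f b *
      ∑' z : Fin d → ℤ, K (reflDiff i (p a) (p b) + fun j => ((2 * r : ℕ) : ℤ) * z j) := by
  have : NeZero (2 * r) := ⟨by lia⟩
  have hsum : ∀ a b, Summable fun z : Fin d → ℤ =>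
      f a * f b * K (reflDiff i (p a) (p b) + fun j => ((2 * r : ℕ) : ℤ) * z j) :=
    fun a b => (hs.comp_injective (injective_add_mul (2 * r) _)).mul_left _
  have hsum' : Summable fun z : Fin d → ℤ => ∑ a, ∑ b, f a * f b *
      K (reflDiff i (p a) (p b) + fun j => ((2 * r : ℕ) : ℤ) * z j) :=
    summable_sum fun a _ => summable_sum fun b _ => hsum a b
  simp only [← tsum_mul_left]
  rw [Finset.sum_congr rfl fun a _ => (Summable.tsum_finsetSum fun b _ => hsum a b).symm,
    ← Summable.tsum_finsetSum fun a _ => summable_sum fun b _ => hsum a b]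
  rw [← (Equiv.funSplitAt i ℤ).symm.tsum_eq]
  have hsum2 := (Equiv.funSplitAt i ℤ).symm.summable_iff.2 hsum'
  refine (Summable.tsum_prod hsum2).symm ▸ tsum_nonneg fun k => ?_
  refine tsum_nonneg_of_sum_sub_nonneg _ (hsum2.prod_factor k) fun N => ?_
  simp only [Function.comp_apply]
  -- The point `a` in the copy of the slab that belongs to `k`, translated by `2 r u` along the
  -- plane. If `k < 0`, the differences leave the half space, and evenness is used to go to their
  -- mirror images, for which the slab has to be reversed.
  let q : Λ × cube {j // j ≠ i} N → Fin d → ℤ := fun c j =>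
    if hj : j = i then
      (if 0 ≤ k then p c.1 i + r * k else r + 1 - p c.1 i + r * (-1 - k))
    else p c.1 j + (2 * r : ℕ) * c.2.1 ⟨j, hj⟩
  have hq : ∀ c, 1 ≤ q c i := by
    intro c
    have h1 := hp c.1
    have h2 := hp' c.1
    simp only [q, dif_pos]
    split_ifs with hk
    · nlinarith
    · have : 0 ≤ (r : ℤ) * (-1 - k) := mul_nonneg (by lia) (by lia)
      lia
  have h := hK _ q (fun c => f c.1) hq
  have hval : ∀ c c' : Λ × cube {j // j ≠ i} N, K (reflDiff i (q c) (q c')) =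
      K (reflDiff i (p c.1) (p c'.1) + fun j =>
        ((2 * r : ℕ) : ℤ) * (Equiv.funSplitAt i ℤ).symm (k, c.2.1 - c'.2.1) j) := by
    intro c c'
    by_cases hk : 0 ≤ k
    · congr 1
      funext j
      by_cases hj : j = i
      · subst hj
        simp [reflDiff, q, hk, Equiv.funSplitAt, Equiv.piSplitAt]
        ring
      · simp [reflDiff, q, hj, Equiv.funSplitAt, Equiv.piSplitAt]
        ring
    · rw [← heven]
      congr 1
      funext j
      by_cases hj : j = i
      · subst hj
        simp [reflDiff, q, hk, Equiv.funSplitAt, Equiv.piSplitAt]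
        ring
      · simp [reflDiff, q, hj, Equiv.funSplitAt, Equiv.piSplitAt]
        ring
  simp only [hval, Fintype.sum_prod_type] at h
  convert h using 1
  simp only [← Finset.sum_coe_sort (cube {j // j ≠ i} N)]
  conv_rhs => rw [Finset.sum_comm]
  refine Finset.sum_congr rfl fun u _ => ?_
  rw [Finset.sum_comm]
  refine Finset.sum_congr rfl fun a _ => ?_
  rw [Finset.sum_comm]

end Lattice

/-! ### Nearest-neighbour, Yukawa and power-law couplings -/

section Basic

variable {d : ℕ} {i : Fin d}

theorem reflDiff_same (i : Fin d) (x y : Fin d → ℤ) : reflDiff i x y i = x i + y i - 1 := by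
  simp [reflDiff]

theorem reflDiff_of_ne {i j : Fin d} (h : j ≠ i) (x y : Fin d → ℤ) :
    reflDiff i x y j = x j - y j := by
  simp [reflDiff, h]

/-- The reflected differences of points of the half space stay in the half space, so that only the
values of the coupling there matter. -/
theorem IsReflectionPositive.congr {K K' : (Fin d → ℤ) → ℝ} (hK : IsReflectionPositive i K)
    (h : ∀ x, 1 ≤ x i → K' x = K x) : IsReflectionPositive i K' := by
  intro ι _ p f hp
  convert hK ι p f hp using 6 with a _ b _
  apply h
  rw [reflDiff_same]
  linarith [hp a, hp b]

theorem IsReflectionPositive.const_mul {K : (Fin d → ℤ) → ℝ} (hK : IsReflectionPositive i K)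
    {c : ℝ} (hc : 0 ≤ c) : IsReflectionPositive i fun x => c * K x := by
  intro ι _ p f hp
  refine (mul_nonneg hc (hK ι p f hp)).trans_eq ?_
  simp only [Finset.mul_sum]
  exact Finset.sum_congr rfl fun a _ => Finset.sum_congr rfl fun b _ => by ring

/-- Integrals of reflection positive couplings are reflection positive. -/
theorem IsReflectionPositive.integral {Ω : Type*} [MeasurableSpace Ω] {μ : Measure Ω}
    {K : Ω → (Fin d → ℤ) → ℝ} (hK : ∀ᵐ ω ∂μ, IsReflectionPositive i (K ω))
    (hint : ∀ x, 1 ≤ x i → Integrable (fun ω => K ω x) μ) :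
    IsReflectionPositive i fun x => ∫ ω, K ω x ∂μ := by
  intro ι _ p f hp
  have hint' : ∀ a b, Integrable (fun ω => f a * f b * K ω (reflDiff i (p a) (p b))) μ := by
    refine fun a b => (hint _ ?_).const_mul _
    rw [reflDiff_same]
    linarith [hp a, hp b]
  simp only [← integral_const_mul]
  rw [Finset.sum_congr rfl fun a _ => (integral_finsetSum _ fun b _ => hint' a b).symm,
    ← integral_finsetSum _ fun a _ => integrable_finsetSum _ fun b _ => hint' a b]
  refine integral_nonneg_of_ae ?_
  filter_upwards [hK] with ω hω using hω ι p f hp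

/-- Positive semidefinite matrices of reflected differences give reflection positivity. -/
theorem isReflectionPositive_of_posSemidef {K : (Fin d → ℤ) → ℝ}
    (h : ∀ (ι : Type) [Fintype ι] (p : ι → Fin d → ℤ), (∀ a, 1 ≤ p a i) →
      (Matrix.of fun a b => K (reflDiff i (p a) (p b))).PosSemidef) :
    IsReflectionPositive i K := by
  intro ι _ p f hp
  refine ((h ι p hp).dotProduct_mulVec_nonneg f).trans_eq ?_
  simp only [dotProduct, Matrix.mulVec, Finset.mul_sum, Matrix.of_apply]
  exact Finset.sum_congr rfl fun a _ => Finset.sum_congr rfl fun b _ => by simp; ring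

theorem posSemidef_prod {ι J : Type*} [Fintype ι] (s : Finset J) (M : J → Matrix ι ι ℝ)
    (hM : ∀ j ∈ s, (M j).PosSemidef) : (Matrix.of fun a b => ∏ j ∈ s, M j a b).PosSemidef := by
  classical
  induction s using Finset.induction_on with
  | empty =>
    convert Matrix.posSemidef_vecMulVec_self_star (fun _ : ι => (1 : ℝ)) using 1
    ext a b
    simp [Matrix.vecMulVec_apply]
  | insert j s hj ih =>
    have h := (hM j (by simp)).hadamard (ih fun k hk => hM k (by simp [hk]))
    have h' : (M j).hadamard (Matrix.of fun a b => ∏ j ∈ s, M j a b) =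
        Matrix.of fun a b => ∏ k ∈ insert j s, M k a b := by
      ext a b
      simp [hj]
    exact h' ▸ h

/-- The kernel `exp (-b |x - y|)` is positive definite: it is the integral over `t` of
`2 b exp (-2 b t) (exp (b x) 1_{t > x}) (exp (b y) 1_{t > y})`. -/
theorem posSemidef_exp_neg_abs {ι : Type*} [Fintype ι] {b : ℝ} (hb : 0 < b) (x : ι → ℝ) :
    (Matrix.of fun k l => Real.exp (-b * |x k - x l|)).PosSemidef := by
  refine Matrix.PosSemidef.of_dotProduct_mulVec_nonneg ?_ fun f => ?_
  · ext k l
    simp [abs_sub_comm]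
  let g : ι → ℝ → ℝ := fun k => (Set.Ioi (x k)).indicator fun _ => Real.exp (b * x k)
  have hg : ∀ k l t, g k t * g l t = (Set.Ioi (max (x k) (x l))).indicator
      (fun _ => Real.exp (b * (x k + x l))) t := by
    intro k l t
    simp only [g, Set.indicator_apply, Set.mem_Ioi, max_lt_iff, ite_mul, mul_ite, mul_zero,
      zero_mul, mul_add, Real.exp_add]
    split_ifs <;> simp_all
  have hint : ∀ k l, Integrable fun t => 2 * b * Real.exp (-(2 * b) * t) * (g k t * g l t) := by
    intro k l
    have h1 := (integrableOn_exp_mul_Ioi (a := -(2 * b)) (by linarith) (max (x k) (x l)))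
    refine ((h1.integrable_indicator measurableSet_Ioi).const_mul
      (2 * b * Real.exp (b * (x k + x l)))).congr (Eventually.of_forall fun t => ?_)
    simp only [hg, Set.indicator_apply]
    split_ifs <;> ring
  have hval : ∀ k l, ∫ t, 2 * b * Real.exp (-(2 * b) * t) * (g k t * g l t) =
      Real.exp (-b * |x k - x l|) := by
    intro k l
    have h1 : ∀ t, 2 * b * Real.exp (-(2 * b) * t) * (g k t * g l t) =
        (Set.Ioi (max (x k) (x l))).indicator
          (fun t => 2 * b * Real.exp (b * (x k + x l)) * Real.exp (-(2 * b) * t)) t := by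
      intro t
      simp only [hg, Set.indicator_apply]
      split_ifs <;> ring
    simp only [h1]
    rw [integral_indicator measurableSet_Ioi, integral_const_mul,
      integral_exp_mul_Ioi (by linarith : -(2 * b) < 0)]
    have h2 : max (x k) (x l) * 2 = x k + x l + |x k - x l| := by
      rcases le_total (x k) (x l) with h | h
      · rw [max_eq_right h, abs_of_nonpos (by linarith)]; ring
      · rw [max_eq_left h, abs_of_nonneg (by linarith)]; ring
    have h3 : -b * |x k - x l| = b * (x k + x l) + -(2 * b) * max (x k) (x l) := by
      linear_combination (-b) * h2.symm
    rw [h3, Real.exp_add]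
    field_simp
  have hnn : 0 ≤ ∫ t, ∑ k, ∑ l, f k * f l *
      (2 * b * Real.exp (-(2 * b) * t) * (g k t * g l t)) := by
    refine integral_nonneg fun t => ?_
    have : ∑ k, ∑ l, f k * f l * (2 * b * Real.exp (-(2 * b) * t) * (g k t * g l t)) =
        2 * b * Real.exp (-(2 * b) * t) * (∑ k, f k * g k t) ^ 2 := by
      rw [pow_two, Finset.sum_mul_sum, Finset.mul_sum]
      refine Finset.sum_congr rfl fun k _ => ?_
      rw [Finset.mul_sum]
      exact Finset.sum_congr rfl fun l _ => by ring
    simp only [this]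
    positivity
  rw [integral_finsetSum _ fun k _ => integrable_finsetSum _ fun l _ => (hint k l).const_mul _,
    Finset.sum_congr rfl fun k _ => integral_finsetSum _ fun l _ => (hint k l).const_mul _] at hnn
  simp only [integral_const_mul, hval] at hnn
  refine hnn.trans_eq ?_
  simp only [dotProduct, Matrix.mulVec, Finset.mul_sum, Matrix.of_apply]
  exact Finset.sum_congr rfl fun a _ => Finset.sum_congr rfl fun b _ => by simp; ring

/-- The Yukawa coupling factorises over the coordinates. Across the plane the factor has rank one,
since the reflected difference is positive there, and the others are positive definite kernels. -/
theorem isReflectionPositive_exp_neg_l1norm {b : ℝ} (hb : 0 < b) :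
    IsReflectionPositive i fun x => Real.exp (-b * l1norm x) := by
  refine isReflectionPositive_of_posSemidef fun ι _ p hp => ?_
  have h := posSemidef_prod Finset.univ (fun j : Fin d => if j = i then
      Real.exp b • Matrix.vecMulVec (fun a => Real.exp (-b * (p a i : ℝ)))
        (star fun a => Real.exp (-b * (p a i : ℝ)))
    else Matrix.of fun k l => Real.exp (-b * |(p k j : ℝ) - p l j|)) (fun j _ => by
      split_ifs
      · exact (Matrix.posSemidef_vecMulVec_self_star _).smul (Real.exp_pos b).le
      · exact posSemidef_exp_neg_abs hb fun a => (p a j : ℝ))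
  convert h using 1
  ext k l
  simp only [Matrix.of_apply, l1norm, Finset.mul_sum, Real.exp_sum]
  refine Finset.prod_congr rfl fun j _ => ?_
  by_cases hj : j = i
  · subst hj
    simp only [reflDiff_same, if_true, Matrix.smul_apply, Matrix.vecMulVec_apply, smul_eq_mul,
      star_trivial, ← Real.exp_add]
    have h1 : (0 : ℝ) ≤ ((p k j + p l j - 1 : ℤ) : ℝ) := by
      exact_mod_cast (by linarith [hp k, hp l] : 0 ≤ p k j + p l j - 1)
    rw [abs_of_nonneg h1]
    push_cast
    congr 1
    ring
  · simp [reflDiff_of_ne hj, hj]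

theorem one_le_l1norm {x : Fin d → ℤ} (hx : 1 ≤ x i) : 1 ≤ l1norm x := by
  have h1 : (1 : ℝ) ≤ |(x i : ℝ)| := by
    rw [abs_of_nonneg (by exact_mod_cast (by linarith : 0 ≤ x i))]
    exact_mod_cast hx
  exact h1.trans (Finset.single_le_sum (f := fun j => |(x j : ℝ)|) (fun j _ => abs_nonneg _)
    (Finset.mem_univ i))

/-- The power law is a superposition of Yukawa couplings. -/
theorem isReflectionPositive_l1norm_rpow {s : ℝ} (hs : 0 < s) :
    IsReflectionPositive i fun x => l1norm x ^ (-s) := by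
  have h := IsReflectionPositive.integral (i := i) (μ := volume.restrict (Set.Ioi (0 : ℝ)))
    (K := fun t x => t ^ (s - 1) * Real.exp (-t * l1norm x)) (by
      filter_upwards [ae_restrict_mem measurableSet_Ioi] with t (ht : 0 < t)
      exact (isReflectionPositive_exp_neg_l1norm ht).const_mul (by positivity)) (fun x hx => by
      have := integrableOn_rpow_mul_exp_neg_mul_rpow (p := 1) (s := s - 1) (b := l1norm x)
        (by linarith) one_pos (by linarith [one_le_l1norm hx])
      refine this.congr (Eventually.of_forall fun t => ?_)
      simp [mul_comm])
  refine (h.const_mul (inv_nonneg.2 (Real.Gamma_pos_of_pos hs).le)).congr fun x hx => ?_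
  have hl : 0 < l1norm x := by linarith [one_le_l1norm hx]
  have h1 := Real.integral_rpow_mul_exp_neg_mul_Ioi hs hl
  simp only [neg_mul, mul_comm (l1norm x)] at h1 ⊢
  rw [h1, one_div, Real.inv_rpow hl.le, Real.rpow_neg hl.le]
  have := (Real.Gamma_pos_of_pos hs).ne'
  field_simp

theorem isReflectionPositive_nearestNeighbour :
    IsReflectionPositive i fun x => if l1norm x = 1 then 1 else 0 := by
  classical
  intro ι _ p f hp
  -- the reflected difference has norm one only for equal points next to the plane
  have h1 : ∀ a b, (if l1norm (reflDiff i (p a) (p b)) = 1 then (1 : ℝ) else 0) =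
      ∑ q ∈ Finset.univ.image p, (if p a = q ∧ q i = 1 then 1 else 0) *
        (if p b = q ∧ q i = 1 then 1 else 0) := by
    intro a b
    have h2 : l1norm (reflDiff i (p a) (p b)) = 1 ↔ p a = p b ∧ p a i = 1 := by
      have h3 : l1norm (reflDiff i (p a) (p b)) =
          (p a i + p b i - 1 : ℤ) + ∑ j ∈ Finset.univ.erase i, |((p a j - p b j : ℤ) : ℝ)| := by
        rw [l1norm, ← Finset.add_sum_erase _ _ (Finset.mem_univ i), reflDiff_same, abs_of_nonneg]
        · congr 1
          exact Finset.sum_congr rfl fun j hj => by rw [reflDiff_of_ne (Finset.ne_of_mem_erase hj)]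
        · exact_mod_cast (by linarith [hp a, hp b] : 0 ≤ p a i + p b i - 1)
      constructor
      · intro h
        rw [h3] at h
        have h4 : (1 : ℝ) ≤ ((p a i + p b i - 1 : ℤ) : ℝ) := by
          exact_mod_cast (by linarith [hp a, hp b] : 1 ≤ p a i + p b i - 1)
        have h5 : 0 ≤ ∑ j ∈ Finset.univ.erase i, |((p a j - p b j : ℤ) : ℝ)| :=
          Finset.sum_nonneg fun j _ => abs_nonneg _
        have h6 : ∑ j ∈ Finset.univ.erase i, |((p a j - p b j : ℤ) : ℝ)| = 0 := by linarith
        have h7 : p a i + p b i - 1 = 1 := by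
          have : ((p a i + p b i - 1 : ℤ) : ℝ) = 1 := by linarith
          exact_mod_cast this
        have h8 : p a i = 1 := by linarith [hp a, hp b]
        have h9 : p b i = 1 := by linarith [hp a, hp b]
        refine ⟨funext fun j => ?_, h8⟩
        by_cases hj : j = i
        · rw [hj, h8, h9]
        · rw [Finset.sum_eq_zero_iff_of_nonneg fun j _ => abs_nonneg _] at h6
          have h10 := abs_eq_zero.1 (h6 j (Finset.mem_erase.2 ⟨hj, Finset.mem_univ j⟩))
          have : p a j - p b j = 0 := by exact_mod_cast h10
          linarith
      · rintro ⟨h, h'⟩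
        rw [h3, ← h, h']
        simp
    simp only [h2]
    rw [Finset.sum_eq_single (p a)]
    · by_cases hab : p b = p a <;> by_cases ha : p a i = 1 <;>
        simp [hab, ha, eq_comm (a := p a) (b := p b)]
    · intro q _ hq
      simp [hq.symm]
    · simp
  simp only [h1, Finset.mul_sum]
  have h2 : ∑ a, ∑ b, ∑ q ∈ Finset.univ.image p, f a * f b *
      ((if p a = q ∧ q i = 1 then (1 : ℝ) else 0) * (if p b = q ∧ q i = 1 then 1 else 0)) =
      ∑ q ∈ Finset.univ.image p, (∑ a, f a * if p a = q ∧ q i = 1 then (1 : ℝ) else 0) ^ 2 := by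
    simp only [pow_two, Finset.sum_mul_sum]
    conv_lhs => enter [2, a]; rw [Finset.sum_comm]
    rw [Finset.sum_comm]
    exact Finset.sum_congr rfl fun q _ => Finset.sum_congr rfl fun a _ =>
      Finset.sum_congr rfl fun b _ => by ring
  rw [h2]
  exact Finset.sum_nonneg fun q _ => sq_nonneg _

end Basic

/-! ### Euclidean power laws -/

section Euclidean

/-- The Laplace transform of the hitting time density, `∫ τ ^ (-3/2) e ^ (-τ r² - κ² / (4 τ)) dτ =
(2 √π / κ) e ^ (-κ r)`, by the substitution `w = r √τ - κ / (2 √τ)`. -/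
theorem integral_rpow_mul_exp_add_inv {κ r : ℝ} (hκ : 0 < κ) (hr : 0 < r) :
    ∫ τ in Set.Ioi (0 : ℝ), τ ^ (-(3 / 2) : ℝ) * Real.exp (-(r ^ 2 * τ) - κ ^ 2 / (4 * τ)) =
      2 * √Real.pi / κ * Real.exp (-(κ * r)) := by
  set S : ℝ → ℝ := fun w => √(w ^ 2 + 2 * κ * r) with hS
  have hpos : ∀ w, 0 < w ^ 2 + 2 * κ * r := fun w => by positivity
  have hSpos : ∀ w, 0 < S w := fun w => Real.sqrt_pos.2 (hpos w)
  have hSsq : ∀ w, S w ^ 2 = w ^ 2 + 2 * κ * r := fun w => Real.sq_sqrt (hpos w).le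
  have habs : ∀ w, |w| < S w := fun w => by
    rw [hS, Real.lt_sqrt (abs_nonneg w), sq_abs]
    linarith [mul_pos (mul_pos two_pos hκ) hr]
  set u : ℝ → ℝ := fun w => (w + S w) / (2 * r) with hu
  have hupos : ∀ w, 0 < u w := fun w => by
    have := (abs_lt.1 (habs w)).1
    exact div_pos (by linarith) (by positivity)
  have hinv : ∀ w, κ / (2 * u w) = (S w - w) / 2 := fun w => by
    have := hupos w
    rw [div_eq_div_iff (by positivity) two_ne_zero, hu]
    field_simp
    nlinarith [hSsq w]
  have hw : ∀ w, r * u w - κ / (2 * u w) = w := fun w => by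
    rw [hinv, hu]
    field_simp
    ring
  have hScont : Continuous S := by fun_prop
  have hS' : ∀ w, HasDerivAt S (w / S w) w := fun w => by
    have h := ((hasDerivAt_pow 2 w).add_const (2 * κ * r)).sqrt (hpos w).ne'
    convert h using 1
    have := (hSpos w).ne'
    simp only [hS]
    field_simp
    norm_num
    ring
  have hu' : ∀ w, HasDerivAt (fun w => u w ^ 2) (2 * u w * (u w / S w)) w := fun w => by
    have h := (((hasDerivAt_id w).add (hS' w)).div_const (2 * r)).pow 2
    refine HasDerivAt.congr_deriv (f := fun w => u w ^ 2) h ?_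
    have := (hSpos w).ne'
    simp only [hu, Pi.add_apply, id]
    field_simp
    norm_num
    field_simp
    ring
  have himg : (fun w => u w ^ 2) '' Set.univ = Set.Ioi 0 := by
    ext τ
    simp only [Set.image_univ, Set.mem_range, Set.mem_Ioi]
    constructor
    · rintro ⟨w, rfl⟩
      exact pow_pos (hupos w) 2
    · intro hτ
      have h1 : 0 < √τ := Real.sqrt_pos.2 hτ
      refine ⟨r * √τ - κ / (2 * √τ), ?_⟩
      have h2 : S (r * √τ - κ / (2 * √τ)) = r * √τ + κ / (2 * √τ) := by
        rw [hS, Real.sqrt_eq_iff_mul_self_eq_of_pos (by positivity)]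
        field_simp
        ring
      have h3 : u (r * √τ - κ / (2 * √τ)) = √τ := by
        simp only [hu, h2]
        field_simp
        ring
      rw [h3, Real.sq_sqrt hτ.le]
  have hinj : Set.InjOn (fun w => u w ^ 2) Set.univ := by
    intro w _ w' _ h
    have : u w = u w' := by
      have h' : u w ^ 2 = u w' ^ 2 := h
      exact (sq_eq_sq₀ (hupos w).le (hupos w').le).1 h'
    rw [← hw w, ← hw w', this]
  rw [← himg, integral_image_eq_integral_abs_deriv_smul MeasurableSet.univ
    (fun w _ => (hu' w).hasDerivWithinAt) hinj, Measure.restrict_univ]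
  clear_value u S
  have hval : ∀ w, |2 * u w * (u w / S w)| • ((u w ^ 2) ^ (-(3 / 2) : ℝ) *
      Real.exp (-(r ^ 2 * u w ^ 2) - κ ^ 2 / (4 * u w ^ 2))) =
      2 / κ * Real.exp (-(κ * r)) *
        (Real.exp (-1 * w ^ 2) - Real.exp (-1 * w ^ 2) * (w / S w)) := by
    intro w
    have h0 := hupos w
    have h1 := hSpos w
    have h2 : (u w ^ 2) ^ (-(3 / 2) : ℝ) = (u w ^ 3)⁻¹ := by
      rw [← Real.rpow_natCast, ← Real.rpow_mul h0.le, ← Real.rpow_natCast (u w) 3,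
        ← Real.rpow_neg h0.le]
      norm_num
    have h3 : -(r ^ 2 * u w ^ 2) - κ ^ 2 / (4 * u w ^ 2) = -(κ * r) + -1 * w ^ 2 := by
      have h4 : κ ^ 2 / (4 * u w ^ 2) = (κ / (2 * u w)) ^ 2 := by
        rw [div_pow, mul_pow]; norm_num
      have h5 : r * u w * (κ / (2 * u w)) = κ * r / 2 := by field_simp
      rw [h4]
      have h6 := hw w
      generalize κ / (2 * u w) = z at h5 h6 ⊢
      linear_combination (-2) * h5 - (r * u w - z + w) * h6
    have h7 : (u w)⁻¹ = (S w - w) / κ := by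
      have := hinv w
      field_simp at this ⊢
      linarith
    rw [abs_of_pos (by positivity), h2, h3, Real.exp_add, smul_eq_mul]
    have h8 : 2 * u w * (u w / S w) * (u w ^ 3)⁻¹ = 2 / S w * (u w)⁻¹ := by
      field_simp
    rw [← mul_assoc, h8, h7]
    field_simp
  simp only [hval]
  have hodd : ∫ w, Real.exp (-1 * w ^ 2) * (w / S w) = 0 := by
    have h := integral_neg_eq_self (fun w => Real.exp (-1 * w ^ 2) * (w / S w)) volume
    have h1 : ∀ w, Real.exp (-1 * (-w) ^ 2) * (-w / S (-w)) =
        -(Real.exp (-1 * w ^ 2) * (w / S w)) := by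
      intro w
      simp [hS, neg_div]
    simp only [h1, integral_neg] at h
    linarith
  have hg := integrable_exp_neg_mul_sq (one_pos)
  have hg' : Integrable fun w => Real.exp (-1 * w ^ 2) * (w / S w) := by
    refine hg.mono (Continuous.aestronglyMeasurable (by
      refine Continuous.mul (by fun_prop) (continuous_id.div hScont fun w => (hSpos w).ne'))) ?_
    refine Eventually.of_forall fun w => ?_
    rw [norm_mul]
    refine mul_le_of_le_one_right (norm_nonneg _) ?_
    rw [Real.norm_eq_abs, abs_div, abs_of_pos (hSpos w)]
    exact div_le_one_of_le₀ (habs w).le (hSpos w).le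
  rw [integral_const_mul, integral_sub hg hg', hodd, integral_gaussian]
  simp
  ring

variable {d : ℕ} {i : Fin d}

/-- The real Fourier transform of a Gaussian on `ℝ ^ d`. -/
theorem integral_exp_neg_mul_cos {b : ℝ} (hb : 0 < b) (p : Fin d → ℝ) :
    ∫ k : Fin d → ℝ, Real.exp (-b * ∑ j, k j ^ 2) * Real.cos (∑ j, p j * k j) =
      (Real.pi / b) ^ ((d : ℝ) / 2) * Real.exp (-(∑ j, p j ^ 2) / (4 * b)) := by
  have hb' : 0 < (b : ℂ).re := by simpa using hb
  have h := GaussianFourier.integral_cexp_neg_mul_sum_add hb' fun j : Fin d => (p j : ℂ) * Complex.I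
  have hint := GaussianFourier.integrable_cexp_neg_mul_sum_add hb'
    fun j : Fin d => (p j : ℂ) * Complex.I
  have h2 := congrArg Complex.re h
  have h3 := integral_re hint
  simp only [RCLike.re_to_complex] at h3
  rw [← h3] at h2
  have h4 : ∀ k : Fin d → ℝ, (Complex.exp (-(b : ℂ) * ∑ j, (k j : ℂ) ^ 2 +
      ∑ j, (p j : ℂ) * Complex.I * (k j : ℂ))).re =
      Real.exp (-b * ∑ j, k j ^ 2) * Real.cos (∑ j, p j * k j) := by
    intro k
    have : -(b : ℂ) * ∑ j, (k j : ℂ) ^ 2 + ∑ j, (p j : ℂ) * Complex.I * (k j : ℂ) =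
        ((-b * ∑ j, k j ^ 2 : ℝ) : ℂ) + ((∑ j, p j * k j : ℝ) : ℂ) * Complex.I := by
      push_cast
      rw [Finset.sum_mul]
      congr 1
      exact Finset.sum_congr rfl fun j _ => by ring
    rw [this, Complex.exp_add, ← Complex.ofReal_exp, Complex.re_ofReal_mul,
      Complex.exp_ofReal_mul_I_re]
  simp only [h4] at h2
  rw [h2]
  have h5 : ((Real.pi : ℂ) / b) ^ ((Fintype.card (Fin d) : ℂ) / 2) =
      (((Real.pi / b) ^ ((d : ℝ) / 2) : ℝ) : ℂ) := by
    rw [Complex.ofReal_cpow (by positivity)]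
    simp
  have h6 : Complex.exp ((∑ j, ((p j : ℂ) * Complex.I) ^ 2) / (4 * b)) =
      ((Real.exp (-(∑ j, p j ^ 2) / (4 * b)) : ℝ) : ℂ) := by
    push_cast
    simp only [mul_pow, Complex.I_sq, mul_neg, mul_one, Finset.sum_neg_distrib]
  rw [h5, h6, ← Complex.ofReal_mul, Complex.ofReal_re]

/-- Plane waves along the plane that decay across it: the rank is two, by the addition theorem. -/
theorem isReflectionPositive_cos_mul_exp (κ : ℝ) (k : Fin d → ℝ) :
    IsReflectionPositive i fun x =>
      Real.cos (∑ j, (if j = i then 0 else (x j : ℝ)) * k j) * Real.exp (-(κ * x i)) := by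
  intro ι _ p f hp
  set e : ι → ℝ := fun a => f a * Real.exp (-(κ * p a i)) with he
  set θ : ι → ℝ := fun a => ∑ j, (if j = i then 0 else (p a j : ℝ)) * k j with hθ
  have h1 : ∀ a b, f a * f b * (Real.cos (∑ j, (if j = i then 0 else
      (reflDiff i (p a) (p b) j : ℝ)) * k j) * Real.exp (-(κ * reflDiff i (p a) (p b) i))) =
      Real.exp κ * (e a * Real.cos (θ a) * (e b * Real.cos (θ b)) +
        e a * Real.sin (θ a) * (e b * Real.sin (θ b))) := by
    intro a b
    have h2 : ∑ j, (if j = i then 0 else (reflDiff i (p a) (p b) j : ℝ)) * k j = θ a - θ b := by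
      rw [hθ, ← Finset.sum_sub_distrib]
      refine Finset.sum_congr rfl fun j _ => ?_
      by_cases hj : j = i
      · simp [hj]
      · simp [hj, reflDiff_of_ne hj, sub_mul]
    have h3 : -(κ * (reflDiff i (p a) (p b) i : ℝ)) = κ + (-(κ * p a i) + -(κ * p b i)) := by
      rw [reflDiff_same]
      push_cast
      ring
    rw [h2, h3, Real.cos_sub, Real.exp_add, Real.exp_add, he]
    ring
  simp only [h1, ← Finset.mul_sum, Finset.sum_add_distrib, ← Finset.sum_mul]
  have h4 := Real.exp_pos κ
  have h5 := mul_self_nonneg (∑ a, e a * Real.cos (θ a))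
  have h6 := mul_self_nonneg (∑ a, e a * Real.sin (θ a))
  positivity

/-- The integrand of the representation of `(r² + ‖p‖²) ^ (-s / 2)`. With `a = (s - d + 1) / 2`, its
integral over `(μ, k)` is a Gamma density in `τ`, and its integral over `τ` is an exponential
in `r`. -/
noncomputable def fourierIntegrand (a r : ℝ) (p : Fin d → ℝ) (τ : ℝ) (ω : ℝ × (Fin d → ℝ)) : ℝ :=
  τ ^ (-(3 / 2) : ℝ) * Real.exp (-(r ^ 2 * τ)) *
    ((ω.1 ^ (a - 1) * Real.exp (-((1 / (4 * τ)) * ω.1))) *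
      (Real.exp (-(1 / (4 * τ)) * ∑ j, ω.2 j ^ 2) * Real.cos (∑ j, p j * ω.2 j)))

/-- The measure `dμ dk` on `(0, ∞) × ℝ ^ d`. -/
noncomputable def massMomentum (d : ℕ) : Measure (ℝ × (Fin d → ℝ)) :=
  (volume.restrict (Set.Ioi (0 : ℝ))).prod volume

instance : SFinite (massMomentum d) := by
  unfold massMomentum
  infer_instance

theorem ae_massMomentum_pos (d : ℕ) : ∀ᵐ ω ∂massMomentum d, 0 < ω.1 :=
  (Measure.quasiMeasurePreserving_fst (μ := volume.restrict (Set.Ioi (0 : ℝ)))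
    (ν := (volume : Measure (Fin d → ℝ)))).ae (ae_restrict_mem measurableSet_Ioi)

theorem integrable_gaussian_cos {b : ℝ} (hb : 0 < b) (p : Fin d → ℝ) :
    Integrable fun k : Fin d → ℝ => Real.exp (-b * ∑ j, k j ^ 2) * Real.cos (∑ j, p j * k j) := by
  have h := (GaussianFourier.integrable_cexp_neg_mul_sum_add (b := (b : ℂ)) (by simpa using hb)
    fun j : Fin d => (0 : ℂ)).norm
  refine h.mono (by fun_prop) (Eventually.of_forall fun k => ?_)
  rw [norm_mul, norm_norm]
  have h1 : ‖Complex.exp (-(b : ℂ) * ∑ j, (k j : ℂ) ^ 2 + ∑ j, (0 : ℂ) * (k j : ℂ))‖ =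
      Real.exp (-b * ∑ j, k j ^ 2) := by
    rw [Complex.norm_exp]
    congr 1
    simp [← Complex.ofReal_pow, ← Complex.ofReal_sum]
  rw [h1, Real.norm_of_nonneg (Real.exp_pos _).le]
  exact mul_le_of_le_one_right (Real.exp_pos _).le (Real.abs_cos_le_one _)

theorem integrable_fourierIntegrand_right {a r τ : ℝ} (ha : 0 < a) (hτ : 0 < τ) (p : Fin d → ℝ) :
    Integrable (fourierIntegrand a r p τ) (massMomentum d) := by
  have h1 : Integrable (fun t : ℝ => t ^ (a - 1) * Real.exp (-((1 / (4 * τ)) * t)))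
      (volume.restrict (Set.Ioi (0 : ℝ))) := by
    have := integrableOn_rpow_mul_exp_neg_mul_rpow (p := 1) (s := a - 1) (b := 1 / (4 * τ))
      (by linarith) one_pos (by positivity)
    refine this.congr (Eventually.of_forall fun t => ?_)
    simp
  exact (h1.mul_prod (integrable_gaussian_cos (by positivity) p)).const_mul _

theorem integral_fourierIntegrand_right {a r τ : ℝ} (ha : 0 < a) (hτ : 0 < τ) (p : Fin d → ℝ) :
    ∫ ω, fourierIntegrand a r p τ ω ∂massMomentum d =
      4 ^ a * Real.Gamma a * (4 * Real.pi) ^ ((d : ℝ) / 2) *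
        (τ ^ (a + (d : ℝ) / 2 - 1 / 2 - 1) * Real.exp (-((r ^ 2 + ∑ j, p j ^ 2) * τ))) := by
  simp only [fourierIntegrand, massMomentum]
  rw [integral_const_mul,
    integral_prod_mul (fun t : ℝ => t ^ (a - 1) * Real.exp (-((1 / (4 * τ)) * t)))
    (fun k : Fin d → ℝ => Real.exp (-(1 / (4 * τ)) * ∑ j, k j ^ 2) * Real.cos (∑ j, p j * k j)),
    Real.integral_rpow_mul_exp_neg_mul_Ioi ha (by positivity),
    integral_exp_neg_mul_cos (by positivity)]
  have h1 : 1 / (1 / (4 * τ)) = 4 * τ := by field_simp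
  have h2 : Real.pi / (1 / (4 * τ)) = 4 * Real.pi * τ := by field_simp
  have h3 : -(∑ j, p j ^ 2) / (4 * (1 / (4 * τ))) = -((∑ j, p j ^ 2) * τ) := by field_simp
  have h4 : a + (d : ℝ) / 2 - 1 / 2 - 1 = -(3 / 2) + a + (d : ℝ) / 2 := by ring
  rw [h1, h2, h3, h4, Real.mul_rpow (by positivity) hτ.le, Real.mul_rpow (by positivity) hτ.le,
    Real.rpow_add hτ, Real.rpow_add hτ, add_mul, neg_add, Real.exp_add]
  ring

theorem integrable_fourierIntegrand {a r : ℝ} (ha : 0 < a) (had : 0 < a + (d : ℝ) / 2 - 1 / 2)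
    (hr : 0 < r) (p : Fin d → ℝ) :
    Integrable (Function.uncurry (fourierIntegrand a r p))
      ((volume.restrict (Set.Ioi (0 : ℝ))).prod (massMomentum d)) := by
  have hmeas : ∀ p : Fin d → ℝ, AEStronglyMeasurable (Function.uncurry (fourierIntegrand a r p))
      ((volume.restrict (Set.Ioi (0 : ℝ))).prod (massMomentum d)) := by
    intro p
    refine Measurable.aestronglyMeasurable ?_
    unfold fourierIntegrand Function.uncurry
    fun_prop
  have hpos := ae_massMomentum_pos d
  have h0 : Integrable (Function.uncurry (fourierIntegrand a r (0 : Fin d → ℝ)))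
      ((volume.restrict (Set.Ioi (0 : ℝ))).prod (massMomentum d)) := by
    rw [integrable_prod_iff (hmeas 0)]
    constructor
    · filter_upwards [ae_restrict_mem measurableSet_Ioi] with τ (hτ : 0 < τ)
      exact integrable_fourierIntegrand_right ha hτ 0
    · have h1 := integrableOn_rpow_mul_exp_neg_mul_rpow (p := 1)
        (s := a + (d : ℝ) / 2 - 1 / 2 - 1) (b := r ^ 2) (by linarith) one_pos (by positivity)
      refine (h1.const_mul (4 ^ a * Real.Gamma a * (4 * Real.pi) ^ ((d : ℝ) / 2))).congr ?_
      filter_upwards [ae_restrict_mem measurableSet_Ioi] with τ (hτ : 0 < τ)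
      have h2 := integral_fourierIntegrand_right (r := r) ha hτ (0 : Fin d → ℝ)
      simp only [Pi.zero_apply, ne_eq, OfNat.ofNat_ne_zero, not_false_eq_true, zero_pow,
        Finset.sum_const_zero, add_zero] at h2
      rw [Real.rpow_one, neg_mul, ← h2]
      refine integral_congr_ae ?_
      filter_upwards [hpos] with ω hω
      refine (Real.norm_of_nonneg ?_).symm
      simp only [fourierIntegrand, Pi.zero_apply, zero_mul, Finset.sum_const_zero, Real.cos_zero]
      positivity
  refine h0.mono (hmeas p) (Eventually.of_forall fun ⟨τ, ω⟩ => ?_)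
  simp only [Function.uncurry, fourierIntegrand, Pi.zero_apply, zero_mul, Finset.sum_const_zero,
    Real.cos_zero, mul_one, norm_mul]
  refine mul_le_mul_of_nonneg_left (mul_le_mul_of_nonneg_left ?_ (by positivity)) (by positivity)
  exact mul_le_of_le_one_right (norm_nonneg _) (Real.abs_cos_le_one _)

theorem integral_fourierIntegrand_left (a : ℝ) {r : ℝ} (hr : 0 < r) (p : Fin d → ℝ)
    {ω : ℝ × (Fin d → ℝ)} (hω : 0 < ω.1) :
    ∫ τ in Set.Ioi (0 : ℝ), fourierIntegrand a r p τ ω =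
      ω.1 ^ (a - 1) * (2 * √Real.pi / √(ω.1 + ∑ j, ω.2 j ^ 2)) *
        (Real.cos (∑ j, p j * ω.2 j) * Real.exp (-(√(ω.1 + ∑ j, ω.2 j ^ 2) * r))) := by
  have hq : 0 < ω.1 + ∑ j, ω.2 j ^ 2 :=
    add_pos_of_pos_of_nonneg hω (Finset.sum_nonneg fun j _ => sq_nonneg _)
  have h := integral_rpow_mul_exp_add_inv (Real.sqrt_pos.2 hq) hr
  have h1 : ∀ τ, fourierIntegrand a r p τ ω = ω.1 ^ (a - 1) * Real.cos (∑ j, p j * ω.2 j) *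
      (τ ^ (-(3 / 2) : ℝ) *
        Real.exp (-(r ^ 2 * τ) - √(ω.1 + ∑ j, ω.2 j ^ 2) ^ 2 / (4 * τ))) := by
    intro τ
    have h2 : -(r ^ 2 * τ) - √(ω.1 + ∑ j, ω.2 j ^ 2) ^ 2 / (4 * τ) =
        -(r ^ 2 * τ) + -((1 / (4 * τ)) * ω.1) + -(1 / (4 * τ)) * ∑ j, ω.2 j ^ 2 := by
      rw [Real.sq_sqrt hq.le]
      ring
    rw [h2, Real.exp_add, Real.exp_add, fourierIntegrand]
    ring
  simp only [h1]
  rw [integral_const_mul, h]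
  ring

theorem l2norm_sq (x : Fin d → ℤ) : l2norm x ^ 2 = ∑ j, (x j : ℝ) ^ 2 :=
  Real.sq_sqrt (Finset.sum_nonneg fun _ _ => sq_nonneg _)

/-- The Euclidean power law is reflection positive: it is a superposition of the kernels
`cos (k · p) e ^ (-κ r)`, where `r` is the coordinate across the plane and `p` the others. -/
theorem isReflectionPositive_l2norm_rpow {s : ℝ} (hs : (d : ℝ) < s) :
    IsReflectionPositive i fun x => l2norm x ^ (-s) := by
  have hd : (1 : ℝ) ≤ d := by exact_mod_cast i.pos
  set a : ℝ := (s - d + 1) / 2 with ha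
  have ha0 : 0 < a := by rw [ha]; linarith
  have had : a + (d : ℝ) / 2 - 1 / 2 = s / 2 := by rw [ha]; ring
  have hs0 : 0 < s / 2 := by linarith
  have hpos := ae_massMomentum_pos d
  set P : (Fin d → ℤ) → Fin d → ℝ := fun x j => if j = i then 0 else (x j : ℝ) with hP
  have hint : ∀ x : Fin d → ℤ, 1 ≤ x i → Integrable
      (Function.uncurry (fourierIntegrand a (x i) (P x)))
      ((volume.restrict (Set.Ioi (0 : ℝ))).prod (massMomentum d)) := fun x hx =>
    integrable_fourierIntegrand ha0 (by rw [had]; exact hs0)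
      (by exact_mod_cast (by linarith : 0 < x i)) _
  have hleft : ∀ x : Fin d → ℤ, 1 ≤ x i →
      (fun ω => ∫ τ in Set.Ioi (0 : ℝ), fourierIntegrand a (x i) (P x) τ ω) =ᵐ[massMomentum d]
      fun ω => ω.1 ^ (a - 1) * (2 * √Real.pi / √(ω.1 + ∑ j, ω.2 j ^ 2)) *
        (Real.cos (∑ j, P x j * ω.2 j) * Real.exp (-(√(ω.1 + ∑ j, ω.2 j ^ 2) * x i))) := by
    intro x hx
    filter_upwards [hpos] with ω hω
    exact integral_fourierIntegrand_left a (by exact_mod_cast (by linarith : 0 < x i)) _ hω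
  have h := IsReflectionPositive.integral (i := i) (μ := massMomentum d)
    (K := fun ω x => ω.1 ^ (a - 1) * (2 * √Real.pi / √(ω.1 + ∑ j, ω.2 j ^ 2)) *
        (Real.cos (∑ j, P x j * ω.2 j) * Real.exp (-(√(ω.1 + ∑ j, ω.2 j ^ 2) * x i)))) (by
      filter_upwards [hpos] with ω hω
      exact (isReflectionPositive_cos_mul_exp _ _).const_mul (by positivity)) (fun x hx =>
      ((hint x hx).integral_prod_right).congr (hleft x hx))
  set C : ℝ := 4 ^ a * Real.Gamma a * (4 * Real.pi) ^ ((d : ℝ) / 2) * Real.Gamma (s / 2) with hC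
  have hCpos : 0 < C := by
    have := Real.Gamma_pos_of_pos ha0
    have := Real.Gamma_pos_of_pos hs0
    have := Real.pi_pos
    positivity
  refine (h.const_mul (inv_nonneg.2 hCpos.le)).congr fun x hx => ?_
  have hx0 : (0 : ℝ) < x i := by exact_mod_cast (by linarith : 0 < x i)
  rw [← integral_congr_ae (hleft x hx), ← integral_integral_swap (hint x hx)]
  have hN : (x i : ℝ) ^ 2 + ∑ j, P x j ^ 2 = l2norm x ^ 2 := by
    rw [l2norm_sq, ← Finset.add_sum_erase _ (fun j => (x j : ℝ) ^ 2) (Finset.mem_univ i),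
      ← Finset.add_sum_erase _ (fun j => P x j ^ 2) (Finset.mem_univ i)]
    simp only [hP, if_true]
    rw [zero_pow two_ne_zero, zero_add]
    congr 1
    exact Finset.sum_congr rfl fun j hj => by rw [if_neg (Finset.ne_of_mem_erase hj)]
  have hl : 0 < l2norm x ^ 2 := by
    rw [← hN]
    exact add_pos_of_pos_of_nonneg (by positivity) (Finset.sum_nonneg fun j _ => sq_nonneg _)
  have hl' : 0 ≤ l2norm x := Real.sqrt_nonneg _
  rw [setIntegral_congr_fun measurableSet_Ioi fun τ hτ =>
    integral_fourierIntegrand_right ha0 hτ (P x)]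
  simp only [had, hN]
  rw [integral_const_mul, Real.integral_rpow_mul_exp_neg_mul_Ioi hs0 hl, one_div,
    Real.inv_rpow hl.le, ← Real.rpow_natCast (l2norm x), ← Real.rpow_mul hl',
    Real.rpow_neg hl']
  have h5 : ((2 : ℕ) : ℝ) * (s / 2) = s := by push_cast; ring
  rw [h5, eq_inv_mul_iff_mul_eq₀ hCpos.ne', hC]
  ring

end Euclidean

/-! ### Couplings on the torus -/

section Periodisation

variable {d ℓ : ℕ}

/-- The sum of `K` over the residue class of `z` modulo `ℓ`. -/
noncomputable def perSum (ℓ : ℕ) (K : (Fin d → ℤ) → ℝ) (z : Fin d → ℤ) : ℝ :=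
  ∑' w : Fin d → ℤ, K (z + fun j => (ℓ : ℤ) * w j)

/-- Couplings that do not change when the signs of some coordinates are changed. -/
def IsSignInvariant (K : (Fin d → ℤ) → ℝ) : Prop :=
  ∀ ε : Fin d → ℤ, (∀ j, ε j * ε j = 1) → ∀ x, K (ε * x) = K x

theorem perSum_add_mul (K : (Fin d → ℤ) → ℝ) (z w : Fin d → ℤ) :
    perSum ℓ K (z + fun j => (ℓ : ℤ) * w j) = perSum ℓ K z := by
  rw [perSum, perSum,
    ← (Equiv.addLeft w).tsum_eq fun w' => K (z + fun j => (ℓ : ℤ) * w' j)]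
  refine tsum_congr fun w' => congrArg K ?_
  funext j
  simp
  ring

/-- The representatives of the coordinates in `perCoupling` may be replaced by any others. -/
theorem perCoupling_eq_perSum [NeZero ℓ] (K : (Fin d → ℤ) → ℝ) {x y : Box d ℓ} {z : Fin d → ℤ}
    (hz : ∀ j, (z j : ZMod ℓ) = x j - y j) : perCoupling K x y = perSum ℓ K z := by
  have h : ∀ j, ∃ k : ℤ, z j = ((x j).val : ℤ) - ((y j).val : ℤ) + (ℓ : ℤ) * k := by
    intro j
    have h1 : ((((x j).val : ℤ) - ((y j).val : ℤ) : ℤ) : ZMod ℓ) = (z j : ZMod ℓ) := by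
      rw [hz]
      push_cast
      simp
    obtain ⟨k, hk⟩ := (ZMod.intCast_eq_intCast_iff_dvd_sub _ _ ℓ).1 h1
    exact ⟨k, by linarith⟩
  choose k hk using h
  have h2 : z = (fun j => ((x j).val : ℤ) - ((y j).val : ℤ)) + fun j => (ℓ : ℤ) * k j :=
    funext hk
  rw [h2, perSum_add_mul]
  rfl

theorem perSum_mul_of_isSignInvariant {K : (Fin d → ℤ) → ℝ} (hK : IsSignInvariant K)
    {ε : Fin d → ℤ} (hε : ∀ j, ε j * ε j = 1) (z : Fin d → ℤ) :
    perSum ℓ K (ε * z) = perSum ℓ K z := by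
  have hinv : Function.Involutive fun w : Fin d → ℤ => ε * w := by
    intro w
    funext j
    simp [← mul_assoc, hε]
  rw [perSum, perSum, ← hinv.toPerm.tsum_eq]
  refine tsum_congr fun w => ?_
  rw [← hK ε hε]
  congr 1
  funext j
  simp only [Function.Involutive.coe_toPerm, Pi.mul_apply, Pi.add_apply]
  linear_combination (z j + (ℓ : ℤ) * w j) * hε j

theorem perCoupling_comm [NeZero ℓ] {K : (Fin d → ℤ) → ℝ} (hK : IsSignInvariant K)
    (x y : Box d ℓ) : perCoupling K x y = perCoupling K y x := by
  have h := perSum_mul_of_isSignInvariant (ℓ := ℓ) hK (ε := fun _ => -1) (by simp)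
    fun j => ((y j).val : ℤ) - ((x j).val : ℤ)
  rw [perCoupling_eq_perSum K (x := x) (y := y) (z := (fun _ => -1) * fun j => ((y j).val : ℤ) -
    ((x j).val : ℤ)) (by intro j; simp), h]
  rfl

theorem perCoupling_reflect_reflect [NeZero ℓ] {K : (Fin d → ℤ) → ℝ} (hK : IsSignInvariant K)
    (i : Fin d) (m : ℤ) (x y : Box d ℓ) :
    perCoupling K (reflect i m x) (reflect i m y) = perCoupling K x y := by
  set ε : Fin d → ℤ := Function.update 1 i (-1) with hε
  have hε' : ∀ j, ε j * ε j = 1 := by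
    intro j
    by_cases hj : j = i
    · subst hj; simp [hε]
    · simp [hε, hj]
  have h := perSum_mul_of_isSignInvariant (ℓ := ℓ) hK hε' fun j => ((x j).val : ℤ) - ((y j).val : ℤ)
  rw [perCoupling_eq_perSum K (z := ε * fun j => ((x j).val : ℤ) - ((y j).val : ℤ)), h]
  · rfl
  · intro j
    by_cases hj : j = i
    · subst hj
      simp [hε, reflect]
    · simp [hε, hj, reflect]

theorem reflect_reflect (i : Fin d) (m : ℤ) (x : Box d ℓ) : reflect i m (reflect i m x) = x := by
  funext j
  by_cases hj : j = i
  · subst hj; simp [reflect]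
  · simp [reflect, hj]

/-- Reflection positivity on the torus: the couplings between the left half and the mirror images
of its sites are positive semidefinite. -/
def IsTorusReflectionPositive (ℓ : ℕ) (i : Fin d) (m : ℤ) (K : (Fin d → ℤ) → ℝ) : Prop :=
  ∀ f : leftHalf ℓ i m → ℝ, ∀ [Fintype (leftHalf ℓ i m)],
    0 ≤ ∑ x, ∑ y, f x * f y * perCoupling K x.1 (reflect i m y.1)

/-- Reflection positivity on the lattice gives reflection positivity on the torus, for all
reflection planes that are perpendicular to the same axis. -/
theorem IsReflectionPositive.torus [NeZero ℓ] (hℓ : Even ℓ) {i : Fin d} (m : ℤ)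
    {K : (Fin d → ℤ) → ℝ} (hK : IsReflectionPositive i K) (hs : Summable K)
    (heven : IsSignInvariant K) : IsTorusReflectionPositive ℓ i m K := by
  intro f _
  obtain ⟨r, rfl⟩ := hℓ
  have hr : 0 < r := by
    have := NeZero.pos (r + r)
    lia
  set ε : Fin d → ℤ := Function.update 1 i (-1) with hε
  have hε' : ∀ j, ε j * ε j = 1 := by
    intro j
    by_cases hj : j = i
    · subst hj; simp [hε]
    · simp [hε, hj]
  have hεK : ∀ x, K (Function.update x i (-x i)) = K x := by
    intro x
    rw [← heven ε hε' x]
    congr 1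
    funext j
    by_cases hj : j = i
    · subst hj; simp [hε]
    · simp [hε, hj]
  -- the coordinate `x_i` is represented by its distance to the plane
  choose k hk hk1 hk2 using fun x : leftHalf (r + r) i m => x.2
  let p : leftHalf (r + r) i m → Fin d → ℤ := fun x j =>
    if j = i then m + 1 - k x else ((x.1 j).val : ℤ)
  have h := hK.periodise hs hεK hr p (fun x => by simp only [p, if_true]; have := hk2 x; lia)
    (fun x => by simp only [p, if_true]; have := hk1 x; push_cast at this; lia) f
  refine h.trans_eq (Finset.sum_congr rfl fun x _ => Finset.sum_congr rfl fun y _ => ?_)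
  congr 1
  have h1 := perSum_mul_of_isSignInvariant (ℓ := r + r) heven hε' (reflDiff i (p x) (p y))
  rw [perCoupling_eq_perSum K (z := ε * reflDiff i (p x) (p y)), h1, perSum, two_mul]
  intro j
  by_cases hj : j = i
  · subst hj
    have hx := hk x
    have hy := hk y
    simp only [hε, Pi.mul_apply, Function.update_self, reflDiff_same, p, if_true, reflect]
    rw [← hx, ← hy]
    push_cast
    ring
  · simp [hε, hj, reflDiff_of_ne hj, p, reflect]

end Periodisation

/-! ### Symmetry and summability -/

section Summability

variable {d : ℕ}

theorem abs_mul_of_mul_self_eq_one {ε : Fin d → ℤ} (hε : ∀ j, ε j * ε j = 1) (x : Fin d → ℤ)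
    (j : Fin d) : |(((ε * x) j : ℤ) : ℝ)| = |(x j : ℝ)| := by
  rcases mul_self_eq_one_iff.1 (hε j) with h | h <;> simp [h]

theorem l1norm_mul {ε : Fin d → ℤ} (hε : ∀ j, ε j * ε j = 1) (x : Fin d → ℤ) :
    l1norm (ε * x) = l1norm x :=
  Finset.sum_congr rfl fun j _ => abs_mul_of_mul_self_eq_one hε x j

theorem l2norm_mul {ε : Fin d → ℤ} (hε : ∀ j, ε j * ε j = 1) (x : Fin d → ℤ) :
    l2norm (ε * x) = l2norm x := by
  unfold l2norm
  congr 1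
  refine Finset.sum_congr rfl fun j _ => ?_
  rw [← sq_abs, abs_mul_of_mul_self_eq_one hε x j, sq_abs]

theorem mul_eq_zero_iff_of_mul_self_eq_one {ε : Fin d → ℤ} (hε : ∀ j, ε j * ε j = 1)
    (x : Fin d → ℤ) : ε * x = 0 ↔ x = 0 := by
  refine ⟨fun h => ?_, fun h => by simp [h]⟩
  funext j
  have h1 := congrFun h j
  have h2 : ε j ≠ 0 := fun h0 => by simpa [h0] using hε j
  exact (mul_eq_zero.1 h1).resolve_left h2

theorem norm_le_l1norm (x : Fin d → ℤ) : ‖fun j => (x j : ℝ)‖ ≤ l1norm x := by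
  refine (pi_norm_le_iff_of_nonneg (Finset.sum_nonneg fun j _ => abs_nonneg _)).2 fun j => ?_
  exact Finset.single_le_sum (f := fun j => |(x j : ℝ)|) (fun j _ => abs_nonneg _)
    (Finset.mem_univ j)

theorem norm_le_l2norm (x : Fin d → ℤ) : ‖fun j => (x j : ℝ)‖ ≤ l2norm x := by
  refine (pi_norm_le_iff_of_nonneg (Real.sqrt_nonneg _)).2 fun j => Real.le_sqrt_of_sq_le ?_
  rw [Real.norm_eq_abs, sq_abs]
  exact Finset.single_le_sum (f := fun j => (x j : ℝ) ^ 2) (fun j _ => sq_nonneg _)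
    (Finset.mem_univ j)

theorem summable_norm_rpow_lattice {s : ℝ} (hs : (d : ℝ) < s) :
    Summable fun x : Fin d → ℤ => ‖fun j => (x j : ℝ)‖ ^ (-s) := by
  set L := Submodule.span ℤ (Set.range (Pi.basisFun ℝ (Fin d)))
  have hrank : Module.finrank ℤ L = d := by
    rw [ZLattice.rank ℝ L, Module.finrank_fin_fun]
  have h := ZLattice.summable_norm_rpow L (-s) (by rw [hrank]; linarith)
  let φ : (Fin d → ℤ) → L := fun x => ⟨fun j => (x j : ℝ), by
    rw [Module.Basis.mem_span_iff_repr_mem]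
    intro j
    exact ⟨x j, by simp⟩⟩
  have hφ : Function.Injective φ := by
    intro x y hxy
    funext j
    have h1 : (x j : ℝ) = (y j : ℝ) := congrFun (congrArg Subtype.val hxy) j
    exact_mod_cast h1
  have h2 : ∀ x : Fin d → ℤ, ‖φ x‖ = ‖fun j => (x j : ℝ)‖ := fun x => rfl
  simpa only [Function.comp_def, h2] using h.comp_injective hφ

/-- A power of a function that dominates the norm is summable below the critical exponent,
whatever the value at the origin. -/
theorem summable_of_eq_rpow {N : (Fin d → ℤ) → ℝ} (hN : ∀ x, ‖fun j => (x j : ℝ)‖ ≤ N x)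
    {s : ℝ} (hs : (d : ℝ) < s) {K : (Fin d → ℤ) → ℝ} {a : ℝ}
    (hK : ∀ x, x ≠ 0 → K x = a * N x ^ (-s)) : Summable K := by
  have hs0 : 0 < s := lt_of_le_of_lt (Nat.cast_nonneg d) hs
  refine ((summable_norm_rpow_lattice hs).mul_left |a|).of_norm_bounded_eventually ?_
  refine (Set.finite_singleton (0 : Fin d → ℤ)).subset fun x hx => ?_
  by_contra h0
  have h0' : x ≠ 0 := h0
  apply hx
  have hpos : 0 < ‖fun j => (x j : ℝ)‖ := by
    rw [norm_pos_iff]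
    intro h
    apply h0'
    funext j
    have h1 : (x j : ℝ) = 0 := congrFun h j
    exact_mod_cast h1
  show ‖K x‖ ≤ |a| * ‖fun j => (x j : ℝ)‖ ^ (-s)
  rw [hK x h0', Real.norm_eq_abs, abs_mul]
  rw [abs_of_nonneg (Real.rpow_nonneg (hpos.le.trans (hN x)) _)]
  exact mul_le_mul_of_nonneg_left
    (Real.rpow_le_rpow_of_nonpos hpos (hN x) (by linarith)) (abs_nonneg _)

theorem summable_exp_neg_l1norm {b : ℝ} (hb : 0 < b) :
    Summable fun x : Fin d → ℤ => Real.exp (-b * l1norm x) := by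
  have h1 : Tendsto (fun t : ℝ => t ^ ((d : ℝ) + 1) * Real.exp (-b * t)) atTop (𝓝 0) :=
    tendsto_rpow_mul_exp_neg_mul_atTop_nhds_zero _ _ hb
  have hd : (d : ℝ) < (d : ℝ) + 1 := by linarith
  obtain ⟨C, hC⟩ : ∃ C, ∀ t : ℝ, 1 ≤ t → t ^ ((d : ℝ) + 1) * Real.exp (-b * t) ≤ C := by
    obtain ⟨T, hT⟩ := eventually_atTop.1 (h1.eventually (gt_mem_nhds one_pos))
    have hcont : ContinuousOn (fun t : ℝ => t ^ ((d : ℝ) + 1) * Real.exp (-b * t))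
        (Set.Icc 1 T) := by
      refine ContinuousOn.mul (fun t ht => ?_) (by fun_prop)
      exact (Real.continuousAt_rpow_const t _ (Or.inl (by linarith [ht.1]))).continuousWithinAt
    obtain ⟨C, hC⟩ := isCompact_Icc.bddAbove_image hcont
    refine ⟨max C 1, fun t ht => ?_⟩
    rcases le_total t T with h | h
    · exact le_max_of_le_left (hC ⟨t, ⟨ht, h⟩, rfl⟩)
    · exact le_max_of_le_right (hT t h).le
  have h2 := summable_of_eq_rpow (d := d) norm_le_l1norm hd
    (K := fun x => C * l1norm x ^ (-((d : ℝ) + 1))) (a := C) fun x _ => rfl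
  refine h2.of_norm_bounded_eventually ?_
  refine (Set.finite_singleton (0 : Fin d → ℤ)).subset fun x hx => ?_
  by_contra h0
  have h0' : x ≠ 0 := h0
  apply hx
  obtain ⟨j, hj⟩ := Function.ne_iff.1 h0'
  have h3 : 1 ≤ l1norm x := by
    have : (1 : ℝ) ≤ |(x j : ℝ)| := by exact_mod_cast Int.one_le_abs hj
    exact this.trans (Finset.single_le_sum (f := fun j => |(x j : ℝ)|) (fun j _ => abs_nonneg _)
      (Finset.mem_univ j))
  have h4 : 0 < l1norm x ^ ((d : ℝ) + 1) := Real.rpow_pos_of_pos (by linarith) _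
  show ‖Real.exp (-b * l1norm x)‖ ≤ C * l1norm x ^ (-((d : ℝ) + 1))
  rw [Real.norm_of_nonneg (Real.exp_pos _).le, Real.rpow_neg (by linarith), ← div_eq_mul_inv,
    le_div_iff₀ h4, mul_comm]
  exact hC _ h3

theorem summable_nearestNeighbour :
    Summable fun x : Fin d → ℤ => if l1norm x = 1 then (1 : ℝ) else 0 := by
  have h : Summable fun x : Fin d → ℤ => Real.exp 1 * Real.exp (-1 * l1norm x) :=
    (summable_exp_neg_l1norm one_pos).mul_left _
  refine h.of_nonneg_of_le (fun x => by split_ifs <;> simp) fun x => ?_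
  split_ifs with hx
  · rw [hx, ← Real.exp_add]
    simp
  · positivity

end Summability

/-! ### Green functions of walks -/

section WalkCount

variable {d : ℕ}

/-- The number of nearest-neighbour walks with `n` steps in `ℤ ^ d` and total displacement `z`. -/
noncomputable def stepCount : ℕ → (Fin d → ℤ) → ℝ
  | 0, z => if z = 0 then 1 else 0
  | n + 1, z => ∑ j, (stepCount n (z - Pi.single j 1) + stepCount n (z + Pi.single j 1))

theorem stepCount_nonneg (n : ℕ) (z : Fin d → ℤ) : 0 ≤ stepCount n z := by
  induction n generalizing z with
  | zero => simp only [stepCount]; split_ifs <;> simp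
  | succ n ih => exact Finset.sum_nonneg fun j _ => add_nonneg (ih _) (ih _)

theorem hasSum_stepCount (n : ℕ) :
    HasSum (fun z : Fin d → ℤ => stepCount n z) ((2 * d : ℝ) ^ n) := by
  induction n with
  | zero => simpa [stepCount] using hasSum_ite_eq (0 : Fin d → ℤ) (1 : ℝ)
  | succ n ih =>
    have h : HasSum (fun z : Fin d → ℤ => stepCount (n + 1) z)
        (∑ _j : Fin d, ((2 * d : ℝ) ^ n + (2 * d : ℝ) ^ n)) :=
      hasSum_sum fun j _ => ((Equiv.subRight (Pi.single j 1)).hasSum_iff.2 ih).add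
        ((Equiv.addRight (Pi.single j 1)).hasSum_iff.2 ih)
    convert h using 1
    simp
    ring

theorem stepCount_mul {ε : Fin d → ℤ} (hε : ∀ j, ε j * ε j = 1) (n : ℕ) (z : Fin d → ℤ) :
    stepCount n (ε * z) = stepCount n z := by
  induction n generalizing z with
  | zero => simp only [stepCount, mul_eq_zero_iff_of_mul_self_eq_one hε]
  | succ n ih =>
    simp only [stepCount]
    refine Finset.sum_congr rfl fun j _ => ?_
    have h1 : ∀ w : Fin d → ℤ, ε * z - w = ε * (z - ε * w) := by
      intro w
      funext k
      simp only [Pi.sub_apply, Pi.mul_apply]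
      linear_combination w k * hε k
    have h2 : ∀ w : Fin d → ℤ, ε * z + w = ε * (z + ε * w) := by
      intro w
      funext k
      simp only [Pi.add_apply, Pi.mul_apply]
      linear_combination (-w k) * hε k
    have h3 : ε * Pi.single j 1 = Pi.single j (ε j) := by
      funext k
      by_cases hk : k = j
      · subst hk; simp
      · simp [hk]
    rw [h1, h2, ih, ih, h3]
    rcases mul_self_eq_one_iff.1 (hε j) with h | h
    · rw [h]
    · rw [h, Pi.single_neg, sub_neg_eq_add, ← sub_eq_add_neg, add_comm]

/-- The Green function `∑_n c ^ n N_n(z)` of the walk. -/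
noncomputable def green (c : ℝ) (z : Fin d → ℤ) : ℝ := ∑' n, c ^ n * stepCount n z

variable {c : ℝ}

theorem summable_green_prod (hc : 0 ≤ c) (hc' : 2 * d * c < 1) :
    Summable fun q : (Fin d → ℤ) × ℕ => c ^ q.2 * stepCount q.2 q.1 := by
  have h0 : ∀ n : ℕ, HasSum (fun z : Fin d → ℤ => c ^ n * stepCount n z)
      (c ^ n * (2 * d : ℝ) ^ n) := fun n => (hasSum_stepCount n).mul_left (c ^ n)
  have h : Summable fun q : ℕ × (Fin d → ℤ) => c ^ q.1 * stepCount q.1 q.2 := by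
    refine (summable_prod_of_nonneg fun q : ℕ × (Fin d → ℤ) =>
      mul_nonneg (pow_nonneg hc q.1) (stepCount_nonneg q.1 q.2)).2 ⟨fun n => (h0 n).summable, ?_⟩
    refine (summable_geometric_of_lt_one (by positivity) hc').congr fun n => ?_
    rw [(h0 n).tsum_eq, ← mul_pow, mul_comm c]
  exact h.prod_symm

theorem summable_green_factor (hc : 0 ≤ c) (hc' : 2 * d * c < 1) (z : Fin d → ℤ) :
    Summable fun n => c ^ n * stepCount n z :=
  (summable_green_prod hc hc').prod_factor z

theorem summable_green (hc : 0 ≤ c) (hc' : 2 * d * c < 1) :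
    Summable fun z : Fin d → ℤ => green c z :=
  (summable_green_prod hc hc').prod

/-- The equation `(1 - T) green = δ_0`, by decomposition after the first step. -/
theorem green_eq (hc : 0 ≤ c) (hc' : 2 * d * c < 1) (z : Fin d → ℤ) :
    green c z = (if z = 0 then 1 else 0) +
      c * ∑ j, (green c (z - Pi.single j 1) + green c (z + Pi.single j 1)) := by
  have hs := summable_green_factor hc hc'
  rw [green, (hs z).tsum_eq_zero_add]
  congr 1
  · simp [stepCount]
  · simp only [green, ← (hs _).tsum_add (hs _)]
    rw [← Summable.tsum_finsetSum fun j _ => (hs _).add (hs _), ← tsum_mul_left]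
    refine tsum_congr fun n => ?_
    simp only [stepCount, pow_succ, Finset.mul_sum]
    exact Finset.sum_congr rfl fun j _ => by ring

theorem one_le_green_zero (hc : 0 ≤ c) (hc' : 2 * d * c < 1) : 1 ≤ green c (0 : Fin d → ℤ) := by
  have h := (summable_green_factor hc hc' (0 : Fin d → ℤ)).le_tsum 0 fun n _ =>
    mul_nonneg (pow_nonneg hc _) (stepCount_nonneg _ _)
  simp only [pow_zero, stepCount, if_true, one_mul] at h
  exact h

theorem isSignInvariant_green : IsSignInvariant (green c : (Fin d → ℤ) → ℝ) := by
  intro ε hε z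
  simp only [green, stepCount_mul hε]

theorem exists_eq_single_of_sum_abs_eq_one {z : Fin d → ℤ} (h : ∑ j, |z j| = 1) :
    ∃ j, z = Pi.single j 1 ∨ z = Pi.single j (-1) := by
  obtain ⟨j, hj⟩ : ∃ j, z j ≠ 0 := by
    by_contra! h0
    simp [h0] at h
  have h1 : |z j| + ∑ k ∈ Finset.univ.erase j, |z k| = 1 := by
    rw [Finset.add_sum_erase _ (fun k => |z k|) (Finset.mem_univ j), h]
  have h2 : 1 ≤ |z j| := Int.one_le_abs hj
  have h3 : 0 ≤ ∑ k ∈ Finset.univ.erase j, |z k| := Finset.sum_nonneg fun k _ => abs_nonneg _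
  have h4 : ∑ k ∈ Finset.univ.erase j, |z k| = 0 := by linarith
  have h5 : |z j| = 1 := by linarith
  rw [Finset.sum_eq_zero_iff_of_nonneg fun k _ => abs_nonneg _] at h4
  refine ⟨j, ?_⟩
  have h6 : ∀ k, k ≠ j → z k = 0 := fun k hk =>
    abs_eq_zero.1 (h4 k (Finset.mem_erase.2 ⟨hk, Finset.mem_univ k⟩))
  rcases (abs_eq (by norm_num)).1 h5 with h7 | h7
  · left
    funext k
    by_cases hk : k = j
    · subst hk; simp [h7]
    · simp [hk, h6 k hk]
  · right
    funext k
    by_cases hk : k = j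
    · subst hk; simp [h7]
    · simp [hk, h6 k hk]

/-- The sign of a step. -/
def stepSign (b : Bool) : ℤ := if b then 1 else -1

/-- The neighbours of a site of `ℤ ^ d` are indexed by a coordinate and a sign. -/
noncomputable def neighborEquiv (u : Fin d → ℤ) :
    Fin d × Bool ≃ (latticeGraph d).neighborSet u :=
  Equiv.ofBijective (fun e => ⟨u + Pi.single e.1 (stepSign e.2), by
    simp only [SimpleGraph.mem_neighborSet, latticeGraph]
    rw [Finset.sum_eq_single e.1]
    · cases e.2 <;> simp [stepSign]
    · intro k _ hk
      simp [hk]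
    · simp⟩) (by
    constructor
    · rintro ⟨j, b⟩ ⟨k, b'⟩ h
      have h1 : (Pi.single j (stepSign b) : Fin d → ℤ) = Pi.single k (stepSign b') := by
        simpa using congrArg Subtype.val h
      have h2 := congrFun h1 j
      by_cases hjk : j = k
      · subst hjk
        cases b <;> cases b' <;> simp_all [stepSign]
      · cases b <;> simp [hjk, stepSign] at h2
    · rintro ⟨w, hw⟩
      have h1 : ∑ j, |(w - u) j| = 1 := by
        have h2 : ∑ j, |u j - w j| = 1 := hw
        simpa only [Pi.sub_apply, abs_sub_comm] using h2
      obtain ⟨j, h | h⟩ := exists_eq_single_of_sum_abs_eq_one h1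
      · exact ⟨(j, true), Subtype.ext (by simp [stepSign, ← h])⟩
      · exact ⟨(j, false), Subtype.ext (by simp [stepSign, ← h])⟩)

noncomputable instance : (latticeGraph d).LocallyFinite :=
  fun u => Fintype.ofEquiv _ (neighborEquiv u)

theorem card_finsetWalkLength (n : ℕ) (u v : Fin d → ℤ) :
    (((latticeGraph d).finsetWalkLength n u v).card : ℝ) = stepCount n (v - u) := by
  induction n generalizing u with
  | zero =>
    by_cases h : u = v
    · subst h
      simp [SimpleGraph.finsetWalkLength, stepCount]
    · have : v - u ≠ 0 := fun h' => h (sub_eq_zero.1 h').symm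
      simp [SimpleGraph.finsetWalkLength, stepCount, h, this]
  | succ n ih =>
    rw [SimpleGraph.finsetWalkLength, Finset.card_biUnion]
    · simp only [Finset.card_map]
      push_cast
      simp only [ih]
      rw [← (neighborEquiv u).sum_comp, Fintype.sum_prod_type]
      simp only [Fintype.sum_bool, stepCount, neighborEquiv, Equiv.ofBijective_apply, stepSign]
      refine Finset.sum_congr rfl fun j _ => ?_
      congr 2
      · simp [sub_sub]
      · simp only [Bool.false_eq_true, if_false, Pi.single_neg]
        abel
    · intro w _ w' _ hw
      rw [Function.onFun, Finset.disjoint_left]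
      intro p hp hp'
      simp only [Finset.mem_map] at hp hp'
      obtain ⟨q, -, rfl⟩ := hp
      obtain ⟨q', -, hq'⟩ := hp'
      injection hq' with _ h1
      exact hw (Subtype.ext h1.symm)

/-- The sum over walks is the sum over their numbers of steps. -/
theorem tsum_walk_eq_green (hc : 0 ≤ c) (hc' : 2 * d * c < 1) (x : Fin d → ℤ) :
    ∑' w : (latticeGraph d).Walk 0 x, c ^ w.length = green c x := by
  have hfin : ∀ n, {w : (latticeGraph d).Walk 0 x // w.length = n} ≃
      (latticeGraph d).finsetWalkLength n 0 x := fun n =>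
    Equiv.subtypeEquivRight fun w => SimpleGraph.mem_finsetWalkLength_iff.symm
  have hsum : ∀ n, HasSum (fun w : {w : (latticeGraph d).Walk 0 x // w.length = n} =>
      c ^ w.1.length) (c ^ n * stepCount n x) := by
    intro n
    have _ : Fintype {w : (latticeGraph d).Walk 0 x // w.length = n} :=
      Fintype.ofEquiv _ (hfin n).symm
    have h1 : ∑ w : {w : (latticeGraph d).Walk 0 x // w.length = n}, c ^ w.1.length =
        c ^ n * stepCount n x := by
      rw [Finset.sum_congr rfl fun w _ => by rw [w.2], Finset.sum_const, nsmul_eq_mul,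
        Finset.card_univ, Fintype.card_congr (hfin n), Fintype.card_coe, card_finsetWalkLength,
        sub_zero, mul_comm]
    exact h1 ▸ hasSum_fintype _
  rw [← (Equiv.sigmaFiberEquiv fun w : (latticeGraph d).Walk 0 x => w.length).tsum_eq]
  have hs : Summable fun q : (n : ℕ) × {w : (latticeGraph d).Walk 0 x // w.length = n} =>
      c ^ q.2.1.length := by
    rw [summable_sigma_of_nonneg fun q => pow_nonneg hc _]
    refine ⟨fun n => (hsum n).summable, ?_⟩
    simpa only [(hsum _).tsum_eq] using summable_green_factor hc hc' x
  exact (hs.tsum_sigma).trans (tsum_congr fun n => (hsum n).tsum_eq)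

end WalkCount

/-! ### Reflection positivity of Green functions on the torus -/

section TorusWalk

/-- The variational comparison behind the reflection positivity of `(1 - T)⁻¹`: let `U` and `W` be
the potentials of the even and the odd extension `Fe`, `Fo` of a source, and let `χ = ±1` be the
side of a site. If making `W` even by the factor `χ` does not decrease `⟨W, T W⟩`, then the even
source has the larger energy, because `U` minimises `⟨u, (1 - T) u⟩ - 2 ⟨u, Fe⟩`. -/
theorem dotProduct_le_of_even_odd {X : Type*} [Fintype X] (T : (X → ℝ) →ₗ[ℝ] (X → ℝ))
    (hsymm : ∀ u w, u ⬝ᵥ T w = w ⬝ᵥ T u) (hpos : ∀ u, 0 ≤ u ⬝ᵥ (u - T u)) (χ : X → ℝ)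
    (hχ : χ * χ = 1) {Fe Fo U W : X → ℝ} (hU : U - T U = Fe) (hW : W - T W = Fo)
    (hF : χ * Fo = Fe) (hcross : W ⬝ᵥ T W ≤ (χ * W) ⬝ᵥ T (χ * W)) : W ⬝ᵥ Fo ≤ U ⬝ᵥ Fe := by
  have h1 := hpos (U - χ * W)
  have h2 : (χ * W) ⬝ᵥ Fe = W ⬝ᵥ Fo := by
    rw [← hF]
    simp only [dotProduct, Pi.mul_apply]
    refine Finset.sum_congr rfl fun x _ => ?_
    have := congrFun hχ x
    simp only [Pi.mul_apply, Pi.one_apply] at this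
    linear_combination W x * Fo x * this
  have h3 : (χ * W) ⬝ᵥ (χ * W) = W ⬝ᵥ W := by
    simp only [dotProduct, Pi.mul_apply]
    refine Finset.sum_congr rfl fun x _ => ?_
    have := congrFun hχ x
    simp only [Pi.mul_apply, Pi.one_apply] at this
    linear_combination W x * W x * this
  have h4 : (χ * W) ⬝ᵥ U - (χ * W) ⬝ᵥ T U = (χ * W) ⬝ᵥ Fe := by rw [← hU, dotProduct_sub]
  have h5 : U ⬝ᵥ U - U ⬝ᵥ T U = U ⬝ᵥ Fe := by rw [← hU, dotProduct_sub]
  have h6 : W ⬝ᵥ W - W ⬝ᵥ T W = W ⬝ᵥ Fo := by rw [← hW, dotProduct_sub]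
  simp only [map_sub, dotProduct_sub, sub_dotProduct] at h1
  rw [hsymm U (χ * W), dotProduct_comm U (χ * W)] at h1
  linarith

variable {d ℓ : ℕ}

/-- The operator `c ∑_{±} ∑_j u (x ± e_j)` on functions on the torus. -/
def hop (ℓ : ℕ) (c : ℝ) : (Box d ℓ → ℝ) →ₗ[ℝ] (Box d ℓ → ℝ) where
  toFun u x := c * ∑ j, (u (x - Pi.single j 1) + u (x + Pi.single j 1))
  map_add' u w := by
    funext x
    simp only [Pi.add_apply, ← mul_add, ← Finset.sum_add_distrib]
    congr 1
    exact Finset.sum_congr rfl fun j _ => by ring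
  map_smul' a u := by
    funext x
    simp only [Pi.smul_apply, smul_eq_mul, RingHom.id_apply, ← mul_add, ← Finset.mul_sum]
    ring

variable [NeZero ℓ] {c : ℝ}

theorem dotProduct_hop (u w : Box d ℓ → ℝ) :
    u ⬝ᵥ hop ℓ c w = c * ∑ j, ∑ x, (w x * u (x + Pi.single j 1) + u x * w (x + Pi.single j 1)) := by
  simp only [dotProduct, hop, LinearMap.coe_mk, AddHom.coe_mk, Finset.mul_sum]
  rw [Finset.sum_comm]
  refine Finset.sum_congr rfl fun j _ => ?_
  simp only [mul_add, Finset.sum_add_distrib]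
  congr 1
  · rw [← Equiv.sum_comp (Equiv.addRight (Pi.single j (1 : ZMod ℓ) : Box d ℓ))]
    refine Finset.sum_congr rfl fun x _ => ?_
    simp
    ring
  · exact Finset.sum_congr rfl fun x _ => by ring

theorem dotProduct_hop_comm (u w : Box d ℓ → ℝ) : u ⬝ᵥ hop ℓ c w = w ⬝ᵥ hop ℓ c u := by
  simp only [dotProduct_hop, add_comm]

theorem dotProduct_sub_hop_nonneg (hc : 0 ≤ c) (hc' : 2 * d * c ≤ 1) (u : Box d ℓ → ℝ) :
    0 ≤ u ⬝ᵥ (u - hop ℓ c u) := by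
  rw [dotProduct_sub, sub_nonneg, dotProduct_hop]
  have h1 : ∀ j : Fin d, ∑ x, (u x * u (x + Pi.single j 1) + u x * u (x + Pi.single j 1)) ≤
      2 * (u ⬝ᵥ u) := by
    intro j
    have h2 : ∑ x : Box d ℓ, u (x + Pi.single j 1) * u (x + Pi.single j 1) = u ⬝ᵥ u :=
      Equiv.sum_comp (Equiv.addRight (Pi.single j (1 : ZMod ℓ) : Box d ℓ)) fun x => u x * u x
    calc ∑ x, (u x * u (x + Pi.single j 1) + u x * u (x + Pi.single j 1))
        ≤ ∑ x, (u x * u x + u (x + Pi.single j 1) * u (x + Pi.single j 1)) :=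
          Finset.sum_le_sum fun x _ => by nlinarith [sq_nonneg (u x - u (x + Pi.single j 1))]
      _ = 2 * (u ⬝ᵥ u) := by rw [Finset.sum_add_distrib, h2, two_mul]; rfl
  have h0 : 0 ≤ u ⬝ᵥ u := Finset.sum_nonneg fun x _ => mul_self_nonneg _
  calc c * ∑ j : Fin d, ∑ x, (u x * u (x + Pi.single j 1) + u x * u (x + Pi.single j 1))
      ≤ c * ∑ _j : Fin d, 2 * (u ⬝ᵥ u) :=
        mul_le_mul_of_nonneg_left (Finset.sum_le_sum fun j _ => h1 j) hc
    _ = 2 * d * c * (u ⬝ᵥ u) := by simp; ring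
    _ ≤ u ⬝ᵥ u := mul_le_of_le_one_left h0 hc'

variable {i : Fin d} {m : ℤ}

theorem mem_rightHalf_iff (hℓ : Even ℓ) (x : Box d ℓ) :
    x ∈ rightHalf ℓ i m ↔ x ∉ leftHalf ℓ i m := by
  have h := isCompl_halves (d := d) (NeZero.pos ℓ) hℓ i m
  rw [← Set.mem_compl_iff, h.compl_eq]

theorem reflect_mem_left_iff (hℓ : Even ℓ) (x : Box d ℓ) :
    reflect i m x ∈ leftHalf ℓ i m ↔ x ∉ leftHalf ℓ i m := by
  rw [← mem_rightHalf_iff hℓ]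
  refine ⟨fun h => ?_, reflect_mem_left⟩
  have := reflect_mem_right h
  rwa [reflect_reflect] at this

/-- The bonds between the two halves of the torus join mirror images. -/
theorem add_single_eq_reflect (hℓ : Even ℓ) {x : Box d ℓ} {j : Fin d}
    (h : ¬(x ∈ leftHalf ℓ i m ↔ x + Pi.single j 1 ∈ leftHalf ℓ i m)) :
    x + Pi.single j 1 = reflect i m x := by
  have hji : j = i := by
    by_contra hji
    apply h
    simp [leftHalf, Ne.symm hji]
  subst hji
  suffices h1 : x j + 1 = ((2 * m + 1 : ℤ) : ZMod ℓ) - x j by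
    funext k
    by_cases hk : k = j
    · subst hk; simp [reflect, h1]
    · simp [reflect, hk]
  by_cases hx : x ∈ leftHalf ℓ j m
  · have hx' : x + Pi.single j 1 ∉ leftHalf ℓ j m := by tauto
    obtain ⟨k, hk, h1, h2⟩ := hx
    have h3 : k = m := by
      by_contra h3
      exact hx' ⟨k + 1, by simp [hk], by lia, by lia⟩
    rw [← hk, h3]
    push_cast
    ring
  · have hx' : x + Pi.single j 1 ∈ leftHalf ℓ j m := by tauto
    have hx2 : x + Pi.single j 1 ∉ rightHalf ℓ j m := by
      rw [mem_rightHalf_iff hℓ]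
      exact not_not.2 hx'
    obtain ⟨k, hk, h1, h2⟩ := (mem_rightHalf_iff hℓ x).2 hx
    have h3 : 2 * k + 1 = 2 * m + 1 + ℓ := by
      obtain ⟨r, hr⟩ := hℓ
      by_contra h3
      exact hx2 ⟨k + 1, by simp [hk], by lia, by lia⟩
    have h4 : ((2 * k + 1 : ℤ) : ZMod ℓ) = ((2 * m + 1 : ℤ) : ZMod ℓ) := by
      rw [h3]
      push_cast
      simp
    rw [← h4, ← hk]
    push_cast
    ring

/-- On the torus, the periodised Green function inverts `1 - T`. -/
theorem perCoupling_green_eq (hc : 0 ≤ c) (hc' : 2 * d * c < 1) (x y : Box d ℓ) :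
    perCoupling (green c) x y = (if x = y then 1 else 0) +
      c * ∑ j, (perCoupling (green c) (x - Pi.single j 1) y +
        perCoupling (green c) (x + Pi.single j 1) y) := by
  have hs : ∀ z : Fin d → ℤ, Summable fun w : Fin d → ℤ => green c (z + fun j => (ℓ : ℤ) * w j) :=
    fun z => (summable_green hc hc').comp_injective (injective_add_mul ℓ z)
  set z : Fin d → ℤ := fun j => ((x j).val : ℤ) - ((y j).val : ℤ) with hz
  have hzx : ∀ j, (z j : ZMod ℓ) = x j - y j := fun j => by simp [hz]
  have h1 : ∀ j, perCoupling (green c) (x - Pi.single j 1) y =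
      perSum ℓ (green c) (z - Pi.single j 1) := by
    intro j
    refine perCoupling_eq_perSum _ fun k => ?_
    by_cases hk : k = j
    · subst hk; simp [hzx]; ring
    · simp [hzx, hk]
  have h2 : ∀ j, perCoupling (green c) (x + Pi.single j 1) y =
      perSum ℓ (green c) (z + Pi.single j 1) := by
    intro j
    refine perCoupling_eq_perSum _ fun k => ?_
    by_cases hk : k = j
    · subst hk; simp [hzx]; ring
    · simp [hzx, hk]
  have hδ : (∑' w : Fin d → ℤ, if (z + fun j => (ℓ : ℤ) * w j) = 0 then (1 : ℝ) else 0) =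
      if x = y then 1 else 0 := by
    by_cases hxy : x = y
    · have hz0 : z = 0 := by
        funext j
        simp [hz, hxy]
      rw [tsum_eq_single 0]
      · simp [hz0, hxy]
        rfl
      · intro w hw
        rw [if_neg]
        intro h
        apply hw
        refine injective_add_mul ℓ z (h.trans ?_)
        funext j
        simp [hz0]
    · rw [if_neg hxy]
      refine (tsum_congr fun w => if_neg fun h => hxy ?_).trans tsum_zero
      funext j
      have h3 := congrArg (Int.cast : ℤ → ZMod ℓ) (congrFun h j)
      simp only [Pi.add_apply, Int.cast_add, hzx, Int.cast_mul, Int.cast_natCast,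
        CharP.cast_eq_zero, zero_mul, add_zero, Pi.zero_apply, Int.cast_zero] at h3
      exact sub_eq_zero.1 h3
  have hδs : Summable fun w : Fin d → ℤ =>
      if (z + fun j => (ℓ : ℤ) * w j) = 0 then (1 : ℝ) else 0 :=
    (hasSum_ite_eq (0 : Fin d → ℤ) (1 : ℝ)).summable.comp_injective (injective_add_mul ℓ z)
  simp only [h1, h2]
  rw [perCoupling_eq_perSum _ hzx, ← hδ]
  simp only [perSum]
  have hs1 : ∀ j : Fin d, Summable fun w : Fin d → ℤ =>
      green c (z - Pi.single j 1 + fun j => (ℓ : ℤ) * w j) +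
        green c (z + Pi.single j 1 + fun j => (ℓ : ℤ) * w j) := fun j => (hs _).add (hs _)
  simp only [← fun j : Fin d => (hs (z - Pi.single j 1)).tsum_add (hs (z + Pi.single j 1))]
  rw [← Summable.tsum_finsetSum fun j _ => hs1 j, ← tsum_mul_left,
    ← hδs.tsum_add ((summable_sum fun j _ => hs1 j).mul_left c)]
  refine tsum_congr fun w => ?_
  rw [green_eq hc hc']
  simp only [add_sub_right_comm, add_right_comm]

/-- The periodised Green function of `1 - T` is reflection positive: for a source `F` on the left
half with mirror image `F'`, the inequality `⟨F, (1 - T)⁻¹ F'⟩ ≥ 0` compares the energies of the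
even source `F + F'` and the odd source `F - F'`. -/
theorem isTorusReflectionPositive_green (hℓ : Even ℓ) (hc : 0 ≤ c) (hc' : 2 * d * c < 1)
    (i : Fin d) (m : ℤ) : IsTorusReflectionPositive ℓ i m (green c) := by
  classical
  intro f _
  set g : Box d ℓ → Box d ℓ → ℝ := perCoupling (green c) with hg
  have hgsymm : ∀ x y, g x y = g y x := perCoupling_comm isSignInvariant_green
  have hgrefl : ∀ x y, g (reflect i m x) (reflect i m y) = g x y :=
    perCoupling_reflect_reflect isSignInvariant_green i m
  let θ : Box d ℓ ≃ Box d ℓ :=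
    (show Function.Involutive (reflect i m : Box d ℓ → Box d ℓ) from reflect_reflect i m).toPerm
  have hθ : ∀ x, θ x = reflect i m x := fun x => rfl
  -- the source, extended by zero, and its mirror image
  let F : Box d ℓ → ℝ := fun x => if h : x ∈ leftHalf ℓ i m then f ⟨x, h⟩ else 0
  let F' : Box d ℓ → ℝ := fun x => F (reflect i m x)
  let pot : (Box d ℓ → ℝ) → Box d ℓ → ℝ := fun A x => ∑ y, g x y * A y
  have hpot : ∀ A, pot A - hop ℓ c (pot A) = A := by
    intro A
    funext x
    have h1 : pot A x = A x + hop ℓ c (pot A) x := by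
      simp only [pot, hop, LinearMap.coe_mk, AddHom.coe_mk, ← Finset.sum_add_distrib, ← add_mul]
      rw [Finset.sum_comm, Finset.mul_sum]
      have h2 : A x = ∑ y, (if x = y then 1 else 0) * A y := by simp
      conv_rhs => rw [h2]
      rw [← Finset.sum_add_distrib]
      refine Finset.sum_congr rfl fun y _ => ?_
      rw [hg, perCoupling_green_eq hc hc' x y, ← Finset.sum_mul]
      ring
    simp [h1]
  let χ : Box d ℓ → ℝ := fun x => if x ∈ leftHalf ℓ i m then 1 else -1
  have hF : ∀ x, x ∉ leftHalf ℓ i m → F x = 0 := fun x hx => dif_neg hx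
  have hF' : ∀ x, x ∈ leftHalf ℓ i m → F' x = 0 := fun x hx =>
    hF _ fun h => (reflect_mem_left_iff hℓ x).1 h hx
  have hodd : ∀ x, pot (F - F') (reflect i m x) = -pot (F - F') x := by
    intro x
    simp only [pot]
    rw [← Equiv.sum_comp θ, ← Finset.sum_neg_distrib]
    refine Finset.sum_congr rfl fun y _ => ?_
    simp only [hθ, hgrefl, Pi.sub_apply, F', reflect_reflect]
    ring
  have key := dotProduct_le_of_even_odd (hop ℓ c) dotProduct_hop_comm
    (dotProduct_sub_hop_nonneg hc hc'.le) χ (by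
      funext x
      simp only [χ, Pi.mul_apply, Pi.one_apply]
      split_ifs <;> norm_num) (hpot (F + F')) (hpot (F - F')) (by
      funext x
      simp only [χ, Pi.mul_apply, Pi.sub_apply, Pi.add_apply]
      split_ifs with hx
      · simp [hF' x hx]
      · simp [hF x hx]) (by
      rw [dotProduct_hop, dotProduct_hop]
      refine mul_le_mul_of_nonneg_left
        (Finset.sum_le_sum fun j _ => Finset.sum_le_sum fun x _ => ?_) hc
      by_cases hx : x ∈ leftHalf ℓ i m ↔ x + Pi.single j 1 ∈ leftHalf ℓ i m
      · refine le_of_eq ?_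
        have : χ x * χ (x + Pi.single j 1) = 1 := by
          simp only [χ]
          split_ifs <;> simp_all
        simp only [Pi.mul_apply]
        linear_combination (-2) * (pot (F - F') x * pot (F - F') (x + Pi.single j 1)) * this
      · have h1 := hodd x
        rw [← add_single_eq_reflect hℓ hx] at h1
        have : χ x * χ (x + Pi.single j 1) = -1 := by
          simp only [χ]
          split_ifs <;> simp_all
        simp only [Pi.mul_apply, h1]
        have h2 := mul_self_nonneg (pot (F - F') x)
        generalize pot (F - F') x = a at *
        have h3 : χ x * a * (χ (x + Pi.single j 1) * -a) = a * a := by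
          linear_combination (-(a * a)) * this
        linarith)
  have hsum : ∑ x : leftHalf ℓ i m, ∑ y : leftHalf ℓ i m, f x * f y * g x.1 (reflect i m y.1) =
      F ⬝ᵥ pot F' := by
    have h1 : ∀ A : Box d ℓ → ℝ, ∑ x, F x * A x = ∑ x : leftHalf ℓ i m, f x * A x.1 := by
      intro A
      refine (Fintype.sum_of_injective Subtype.val Subtype.val_injective _ _ (fun x hx => ?_)
        fun x => ?_).symm
      · rw [hF x fun h => hx ⟨⟨x, h⟩, rfl⟩, zero_mul]
      · simp [F]
    have h2 : ∀ x, pot F' x = ∑ y, F y * g x (reflect i m y) := by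
      intro x
      simp only [pot, F']
      rw [← Equiv.sum_comp θ]
      refine Finset.sum_congr rfl fun y _ => ?_
      rw [hθ, reflect_reflect, mul_comm]
    rw [dotProduct, h1]
    refine Finset.sum_congr rfl fun x _ => ?_
    rw [h2, h1, Finset.mul_sum]
    exact Finset.sum_congr rfl fun y _ => by ring
  have hpotsymm : ∀ A B, B ⬝ᵥ pot A = A ⬝ᵥ pot B := by
    intro A B
    simp only [dotProduct, pot, Finset.mul_sum]
    rw [Finset.sum_comm]
    refine Finset.sum_congr rfl fun x _ => Finset.sum_congr rfl fun y _ => ?_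
    rw [hgsymm]
    ring
  have hpotadd : ∀ A B, pot (A + B) = pot A + pot B := by
    intro A B
    funext x
    simp [pot, mul_add, Finset.sum_add_distrib]
  have hpotsub : ∀ A B, pot (A - B) = pot A - pot B := by
    intro A B
    funext x
    simp [pot, mul_sub, Finset.sum_sub_distrib]
  show 0 ≤ ∑ x : leftHalf ℓ i m, ∑ y : leftHalf ℓ i m, f x * f y * g x.1 (reflect i m y.1)
  rw [hsum]
  simp only [hpotadd, hpotsub, dotProduct_add, add_dotProduct, dotProduct_sub, sub_dotProduct,
    dotProduct_comm (pot _)] at key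
  rw [hpotsymm F F'] at key
  linarith

end TorusWalk

/-! ### Admissible couplings on the torus -/

section TorusCoupling

variable {d ℓ : ℕ} {i : Fin d} {m : ℤ}

/-- The properties of a coupling that the reflection argument uses. -/
structure IsTorusCoupling (ℓ : ℕ) (i : Fin d) (m : ℤ) (K : (Fin d → ℤ) → ℝ) : Prop where
  summable : Summable K
  isSignInvariant : IsSignInvariant K
  isTorusReflectionPositive : IsTorusReflectionPositive ℓ i m K

theorem IsTorusCoupling.smul {K : (Fin d → ℤ) → ℝ} (hK : IsTorusCoupling ℓ i m K) {a : ℝ}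
    (ha : 0 ≤ a) : IsTorusCoupling ℓ i m (a • K) where
  summable := hK.1.mul_left a
  isSignInvariant ε hε x := by rw [Pi.smul_apply, Pi.smul_apply, hK.2 ε hε]
  isTorusReflectionPositive f _ := by
    have h : ∀ x y : Box d ℓ, perCoupling (a • K) x y = a * perCoupling K x y :=
      fun x y => tsum_mul_left
    have h1 : ∀ b c : ℝ, b * (a * c) = a * (b * c) := fun b c => by ring
    simp only [h, h1, ← Finset.mul_sum]
    exact mul_nonneg ha (hK.3 f)

variable [NeZero ℓ]

theorem summable_perCoupling {K : (Fin d → ℤ) → ℝ} (hK : Summable K) (x y : Box d ℓ) :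
    Summable fun z : Fin d → ℤ =>
      K (fun j => ((x j).val : ℤ) - ((y j).val : ℤ) + (ℓ : ℤ) * z j) :=
  hK.comp_injective (injective_add_mul ℓ fun j => ((x j).val : ℤ) - ((y j).val : ℤ))

theorem IsTorusCoupling.add {K K' : (Fin d → ℤ) → ℝ} (hK : IsTorusCoupling ℓ i m K)
    (hK' : IsTorusCoupling ℓ i m K') : IsTorusCoupling ℓ i m (K + K') where
  summable := hK.1.add hK'.1
  isSignInvariant ε hε x := by
    rw [Pi.add_apply, Pi.add_apply, hK.2 ε hε, hK'.2 ε hε]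
  isTorusReflectionPositive f _ := by
    have h : ∀ x y : Box d ℓ, perCoupling (K + K') x y = perCoupling K x y + perCoupling K' x y :=
      fun x y => (summable_perCoupling hK.1 x y).tsum_add (summable_perCoupling hK'.1 x y)
    simp only [h, mul_add, Finset.sum_add_distrib]
    exact add_nonneg (hK.3 f) (hK'.3 f)

/-- Convex combinations may be taken, since the periodisation is linear in the coupling. -/
theorem convex_isTorusCoupling : Convex ℝ {K | IsTorusCoupling ℓ i m K} :=
  fun _ hK _ hK' _ _ ha hb _ => (hK.smul ha).add (hK'.smul hb)

theorem l1norm_single (i : Fin d) : l1norm (Pi.single i (1 : ℤ)) = 1 := by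
  simp [l1norm, Pi.single_apply, apply_ite]

theorem l2norm_single (i : Fin d) : l2norm (Pi.single i (1 : ℤ)) = 1 := by
  simp [l2norm, Pi.single_apply, apply_ite]

/-- A power law with an arbitrary value at the origin. -/
theorem isTorusCoupling_of_eq_rpow (hℓ : Even ℓ) {N : (Fin d → ℤ) → ℝ}
    (hN : ∀ x, ‖fun j => (x j : ℝ)‖ ≤ N x)
    (hNε : ∀ ε : Fin d → ℤ, (∀ j, ε j * ε j = 1) → ∀ x, N (ε * x) = N x)
    {s : ℝ} (hs : (d : ℝ) < s) (hrp : IsReflectionPositive i fun x => N x ^ (-s)) {a : ℝ}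
    (ha : 0 ≤ a) {K : (Fin d → ℤ) → ℝ} (hK : ∀ x, x ≠ 0 → K x = a * N x ^ (-s)) :
    IsTorusCoupling ℓ i m K := by
  have h1 : Summable K := summable_of_eq_rpow hN hs hK
  have h2 : IsSignInvariant K := by
    intro ε hε x
    by_cases hx : x = 0
    · rw [hx, mul_zero]
    · rw [hK x hx, hK _ ((mul_eq_zero_iff_of_mul_self_eq_one hε x).not.2 hx), hNε ε hε]
  refine ⟨h1, h2, IsReflectionPositive.torus hℓ m ((hrp.const_mul ha).congr fun x hx => ?_) h1 h2⟩
  refine hK x fun h => ?_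
  rw [h] at hx
  exact absurd hx (by simp)

theorem isTorusCoupling_green (hℓ : Even ℓ) {c : ℝ} (hc : 0 ≤ c) (hc' : 2 * d * c < 1) :
    IsTorusCoupling ℓ i m (green c) :=
  ⟨summable_green hc hc', isSignInvariant_green, isTorusReflectionPositive_green hℓ hc hc' i m⟩

theorem IsBasicCoupling.isTorusCoupling (hℓ : Even ℓ) {K : (Fin d → ℤ) → ℝ}
    (hK : IsBasicCoupling K) (h0 : ∀ x, 0 ≤ K x) : IsTorusCoupling ℓ i m K := by
  have hd : 0 < (d : ℝ) := by exact_mod_cast i.pos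
  have hne : (Pi.single i (1 : ℤ) : Fin d → ℤ) ≠ 0 := by simp
  -- the amplitude is nonnegative because some value of `K` is a positive multiple of it
  rcases hK with ⟨a, h⟩ | ⟨a, b, hb, h⟩ | ⟨a, s, hs, h⟩ | ⟨a, lam, hl0, hl1, h⟩ | ⟨a, s, hs, h⟩
  · have ha : 0 ≤ a := by simpa [h, l1norm_single] using h0 (Pi.single i 1)
    obtain rfl : K = a • fun x => if l1norm x = 1 then (1 : ℝ) else 0 := by
      funext x
      simp [h]
    have h2 : IsSignInvariant fun x : Fin d → ℤ => if l1norm x = 1 then (1 : ℝ) else 0 :=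
      fun ε hε x => by simp only [l1norm_mul hε]
    exact IsTorusCoupling.smul ⟨summable_nearestNeighbour, h2,
      isReflectionPositive_nearestNeighbour.torus hℓ m summable_nearestNeighbour h2⟩ ha
  · have ha : 0 ≤ a := by simpa [h, l1norm] using h0 0
    obtain rfl : K = a • fun x => Real.exp (-b * l1norm x) := funext h
    have h2 : IsSignInvariant fun x : Fin d → ℤ => Real.exp (-b * l1norm x) :=
      fun ε hε x => by simp only [l1norm_mul hε]
    exact IsTorusCoupling.smul ⟨summable_exp_neg_l1norm hb, h2,
      (isReflectionPositive_exp_neg_l1norm hb).torus hℓ m (summable_exp_neg_l1norm hb) h2⟩ ha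
  · have ha : 0 ≤ a := by simpa [h _ hne, l1norm_single] using h0 (Pi.single i 1)
    exact isTorusCoupling_of_eq_rpow hℓ norm_le_l1norm (fun ε hε => l1norm_mul hε) hs
      (isReflectionPositive_l1norm_rpow (hd.trans hs)) ha h
  · have hc : 0 ≤ lam / (2 * d) := by positivity
    have hc' : 2 * d * (lam / (2 * d)) < 1 := by
      rwa [mul_div_cancel₀ _ (by positivity)]
    obtain rfl : K = a • green (lam / (2 * d)) := by
      funext x
      rw [h, tsum_walk_eq_green hc hc']
      rfl
    have ha : 0 ≤ a :=
      nonneg_of_mul_nonneg_left (h0 0) (one_pos.trans_le (one_le_green_zero hc hc'))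
    exact (isTorusCoupling_green hℓ hc hc').smul ha
  · have ha : 0 ≤ a := by simpa [h _ hne, l2norm_single] using h0 (Pi.single i 1)
    exact isTorusCoupling_of_eq_rpow hℓ norm_le_l2norm (fun ε hε => l2norm_mul hε) hs
      (isReflectionPositive_l2norm_rpow hs) ha h

theorem isTorusCoupling_of_mem_couplings (hℓ : Even ℓ) {K : (Fin d → ℤ) → ℝ}
    (hK : K ∈ Couplings d) : IsTorusCoupling ℓ i m K :=
  convexHull_min (fun _ hK' => hK'.1.isTorusCoupling hℓ hK'.2) convex_isTorusCoupling hK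

end TorusCoupling

/-! ### The two halves of the box -/

section Reflection

variable {d ℓ : ℕ} {i : Fin d} {m : ℤ}

theorem reflectToLeft_reflectToRight (v₁ : leftHalf ℓ i m → ℝ) :
    reflectToLeft (reflectToRight v₁) = v₁ := by
  funext x
  exact congrArg v₁ (Subtype.ext (reflect_reflect i m x.1))

variable [NeZero ℓ]

theorem sum_perCoupling_reflect {K : (Fin d → ℤ) → ℝ} (hK : IsSignInvariant K) (x : Box d ℓ) :
    ∑ y, perCoupling K (reflect i m x) y = ∑ y, perCoupling K x y := by
  have hθ : Function.Involutive (reflect i m : Box d ℓ → Box d ℓ) := reflect_reflect i m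
  rw [← Equiv.sum_comp hθ.toPerm]
  exact Finset.sum_congr rfl fun y _ => perCoupling_reflect_reflect hK i m x y

/-- The coupling matrix between the left half and the mirror images of its sites. -/
theorem IsTorusCoupling.posSemidef [Fintype (leftHalf ℓ i m)] {K : (Fin d → ℤ) → ℝ}
    (hK : IsTorusCoupling ℓ i m K) {β : ℝ} (hβ : 0 ≤ β) :
    (Matrix.of fun a b : leftHalf ℓ i m =>
      β * perCoupling K a.1 (reflect i m b.1)).PosSemidef := by
  refine Matrix.PosSemidef.of_dotProduct_mulVec_nonneg ?_ fun f => ?_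
  · ext a b
    simp only [Matrix.conjTranspose_apply, Matrix.of_apply, star_trivial]
    rw [← perCoupling_reflect_reflect hK.2 i m, reflect_reflect, perCoupling_comm hK.2]
  · refine (mul_nonneg hβ (hK.3 f)).trans_eq ?_
    simp only [dotProduct, Matrix.mulVec, Matrix.of_apply, star_trivial, Finset.mul_sum,
      Pi.star_apply]
    exact Finset.sum_congr rfl fun a _ => Finset.sum_congr rfl fun b _ => by ring

/-- The box as two copies of its left half, the second one being reflected to the right. -/
noncomputable def halvesEquiv (hℓ : Even ℓ) (i : Fin d) (m : ℤ) :
    leftHalf ℓ i m ⊕ leftHalf ℓ i m ≃ Box d ℓ :=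
  Equiv.ofBijective (Sum.elim Subtype.val fun x => reflect i m x.1) <| by
    refine ⟨Function.Injective.sumElim Subtype.val_injective (fun a b h => ?_) fun a b h => ?_,
      fun x => ?_⟩
    · have h1 := congrArg (reflect i m) h
      simp only [reflect_reflect] at h1
      exact Subtype.ext h1
    · refine (reflect_mem_left_iff hℓ b.1).1 ?_ b.2
      rw [← h]
      exact a.2
    · by_cases hx : x ∈ leftHalf ℓ i m
      · exact ⟨Sum.inl ⟨x, hx⟩, rfl⟩
      · exact ⟨Sum.inr ⟨reflect i m x, (reflect_mem_left_iff hℓ x).2 hx⟩, reflect_reflect i m x⟩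

theorem glue_halvesEquiv (hℓ : Even ℓ) (v₁ : leftHalf ℓ i m → ℝ) (v₂ : rightHalf ℓ i m → ℝ)
    (p : leftHalf ℓ i m ⊕ leftHalf ℓ i m) :
    glue v₁ v₂ (halvesEquiv hℓ i m p) = Sum.elim v₁ (reflectToLeft v₂) p := by
  rcases p with a | a
  · exact dif_pos a.2
  · have h1 : reflect i m a.1 ∉ leftHalf ℓ i m := fun h => (reflect_mem_left_iff hℓ a.1).1 h a.2
    exact (dif_neg h1).trans (dif_pos (reflect_mem_right a.2))

end Reflection

end SpinRP

theorem lemma5p2 {d ℓ n : ℕ} [NeZero ℓ] (hℓ : Even ℓ) (hn : 2 ≤ n) (β : ℝ) (hβ : 0 ≤ β)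
    (J : Fin 3 → (Fin d → ℤ) → ℝ)
    (hJ₁ : J 0 ∈ SpinRP.Couplings d) (hJ₂ : -J 1 ∈ SpinRP.Couplings d)
    (hJ₃ : J 2 ∈ SpinRP.Couplings d)
    (hJ : ∀ x, J 0 x ≤ J 2 x ∧ -J 1 x ≤ J 0 x ∧ 0 ≤ -J 1 x)
    (i : Fin d) (m : ℤ)
    (v₁ : SpinRP.leftHalf ℓ i m → ℝ) (v₂ : SpinRP.rightHalf ℓ i m → ℝ) :
    SpinRP.modifiedPartitionFunction n J β (SpinRP.glue v₁ v₂) ^ 2 ≤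
      SpinRP.modifiedPartitionFunction n J β (SpinRP.glue v₁ (SpinRP.reflectToRight v₁)) *
        SpinRP.modifiedPartitionFunction n J β (SpinRP.glue (SpinRP.reflectToLeft v₂) v₂) := by
  classical
  have : Fintype (SpinRP.leftHalf ℓ i m) := Fintype.ofFinite _
  -- with the sign of `spinSign`, all three couplings are of the admissible kind
  have hJs : ∀ k, ∃ K, SpinRP.IsTorusCoupling ℓ i m K ∧
      ∀ x y : SpinRP.Box d ℓ, SpinRP.spinSign k * SpinRP.perCoupling (J k) x y =
        SpinRP.perCoupling K x y := by
    intro k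
    fin_cases k
    · exact ⟨J 0, SpinRP.isTorusCoupling_of_mem_couplings hℓ hJ₁, fun x y => by
        simp [SpinRP.spinSign]⟩
    · exact ⟨-J 1, SpinRP.isTorusCoupling_of_mem_couplings hℓ hJ₂, fun x y => by
        simp [SpinRP.spinSign, SpinRP.perCoupling, tsum_neg]⟩
    · exact ⟨J 2, SpinRP.isTorusCoupling_of_mem_couplings hℓ hJ₃, fun x y => by
        simp [SpinRP.spinSign]⟩
  choose K hK hKJ using hJs
  have hK2 : SpinRP.IsSignInvariant (J 2) :=
    (SpinRP.isTorusCoupling_of_mem_couplings (i := i) (m := m) hℓ hJ₃).isSignInvariant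
  simp only [SpinRP.modifiedPartitionFunction_eq J β (SpinRP.perCoupling_comm hK2), hKJ]
  refine SpinRP.trace_exp_pairOp_sq_le (SpinRP.halvesEquiv hℓ i m) _ _ _
    (fun k x y => ?_) (fun k a b => ?_) (fun a => ?_) (fun k => (hK k).posSemidef hβ)
    v₁ (SpinRP.reflectToLeft v₂) _ _ _ (SpinRP.glue_halvesEquiv hℓ v₁ v₂) (fun p => ?_)
    fun p => SpinRP.glue_halvesEquiv hℓ _ v₂ p
  · rw [SpinRP.perCoupling_comm (hK k).isSignInvariant]
  · exact congrArg (β * ·) (SpinRP.perCoupling_reflect_reflect (hK k).isSignInvariant i m a.1 b.1)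
  · have h := SpinRP.sum_perCoupling_reflect (i := i) (m := m) hK2 a.1
    funext u
    exact congrArg (fun r : ℝ => (β * r) • (u • SpinRP.realSpinMatrix n 2 + (u ^ 2 / 4) • 1)) h
  · rw [SpinRP.glue_halvesEquiv, SpinRP.reflectToLeft_reflectToRight]
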